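/- Let $z\in\mathbb C\setminus\{0\}$, with $-\pi<\arg z\le\pi$ and $\log z=\ln|z|+i\arg z$. Let $J_\mu(z)=(z/2)^\mu\sum_{k\ge0}\frac{(-1)^k(z/2)^{2k}}{k!\,\Gamma(\mu+k+1)}$ (with $1/\Gamma=0$ at the poles of $\Gamma$), $Y_\mu=\frac{J_\mu\cos\mu\pi-J_{-\mu}}{\sin\mu\pi}$ for $\mu\notin\mathbb Z$, $Y_m=\lim_{\mu\to m}Y_\mu$ for $m\in\mathbb Z$, $H^{(1)}_\mu=J_\mu+iY_\mu$ and $H^{(2)}_\mu=J_\mu-iY_\mu$. For $x\in\mathbb R$ let $\langle x\rangle$ be the nearest integer, with $\langle n+\tfrac12\rangle=n$ for $n\in\mathbb Z$, and for $\mu\in\mathbb C$ let $\{\mu\}=\mu-\langle\mathrm{Re}\,\mu\rangle$, so that $-\tfrac12<\mathrm{Re}\{\mu\}\le\tfrac12$. Let $P(\nu,w)=w^\nu\gamma^*(\nu,w)$ be the normalised lower incomplete gamma function, where $\gamma^*(\nu,w)=\frac1{\Gamma(\nu)}\sum_{k\ge0}\frac{(-w)^k}{(\nu+k)\,k!}$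 for $\nu\ne0,-1,-2,\dots$ and $\gamma^*(-n,w)=w^n$ for $n=0,1,2,\dots$; let $\Gamma(a,w)=\int_w^\infty t^{a-1}e^{-t}\,dt$ be the upper incomplete gamma function. Below, powers, $P$ and $\Gamma(0,\cdot)$ at the points $-iz(1+\cos\theta)$ and $-2iz$ are taken with the argument of these points equal to $\arg z-\frac\pi2\in(-\frac{3\pi}2,\frac\pi2]$, that is, by analytic continuation along the Riemann surface of the logarithm; these are the principal values if $-\frac\pi2<\arg z\le\pi$. Moreover $i^\mu=e^{i\pi\mu/2}$. Put $$B_\mu(z)=\frac{i^\mu}{\pi}\int_0^\pi e^{-iz\cos\theta}P(\{\mu\},-iz(1+\cos\theta))\cos\mu\theta\,d\theta ,$$ $$\chi_\mu(z)=\frac{i^\mu}{\sqrt\pi}e^{iz}\sum_{j=1}^{-\langle\mathrm{Re}\,\mu\rangle}\frac{\Gamma(j+\mu-\frac12)}{\Gamma(j)\Gamma(j+2\mu)}(-2iz)^{j+\mu-1}\ \text{ if }\mathrm{Re}\,\mu\le-\tfrac12,\qquad \chi_\mu(z)=0\ \text{ if }\mathrm{Re}\,\mu>-\tfrac12 .$$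 If $\mu=m+\frac12$ with $m\in\{-1,-2,\dots\}$, the quotient $\Gamma(j+\mu-\frac12)/\Gamma(j+2\mu)$ is replaced by its limit $2(-1)^{m+1}\Gamma(-j-2m)/\Gamma(-j-m+1)$. For $\mu\notin\mathbb Z$ let $$\mathcal H^{(1)}_\mu(z)=\frac{e^{-i\mu\pi}B_\mu(z)-B_{-\mu}(z)}{\sin\mu\pi},\qquad \mathcal H^{(2)}_\mu(z)=\frac{e^{i\mu\pi}B_\mu(z)-B_{-\mu}(z)}{\sin\mu\pi},$$ and let $T_\mp(\mu)=e^{\mp i\mu\pi}$ if $\mathrm{Re}\,\mu<0$, $T_\mp(\mu)=-1$ if $\mathrm{Re}\,\mu\ge0$. Finally let, for $m\in\mathbb Z$, $$\sigma_m(z)=\frac{(-1)^m}{\sqrt\pi}e^{iz}\sum_{j=1}^{|m|}\frac{\Gamma(\frac12-j)\Gamma(j+|m|)}{\Gamma(|m|-j+1)}(2iz)^{-j}.$$ Then: (i) The integral defining $B_\mu(z)$ converges absolutely for every $\mu\in\mathbb C$. (ii) For every $\mu\in\mathbb C\setminus\mathbb Z$, $$-iH^{(1)}_\mu(z)=\mathcal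 H^{(1)}_\mu(z)+T_-(\mu)\frac{\chi_{-\mu\,\mathrm{sgn}(\mathrm{Re}\,\mu)}(z)}{\sin\mu\pi},\qquad iH^{(2)}_\mu(z)=\mathcal H^{(2)}_\mu(z)+T_+(\mu)\frac{\chi_{-\mu\,\mathrm{sgn}(\mathrm{Re}\,\mu)}(z)}{\sin\mu\pi},$$ and, if moreover $\mathrm{Re}\{\mu\}<\tfrac12$, $$\mathcal H^{(1)}_\mu(z)=\frac{i^{-\mu}}{\pi\sin\mu\pi}\int_0^\pi e^{-iz\cos\theta}\left[P(\{\mu\},-iz(1+\cos\theta))-P(-\{\mu\},-iz(1+\cos\theta))\right]\cos\mu\theta\,d\theta,$$ $$\mathcal H^{(2)}_\mu(z)=\frac{i^{\mu}}{\pi\sin\mu\pi}\int_0^\pi e^{-iz\cos\theta}\left[e^{i\mu\pi}P(\{\mu\},-iz(1+\cos\theta))-e^{-i\mu\pi}P(-\{\mu\},-iz(1+\cos\theta))\right]\cos\mu\theta\,d\theta.$$ (iii) For $m\in\mathbb Z$ the two representations in (ii) hold in the limit: as $\mu\to m$, $\mu\neq m$, their right-hand sides tend to $-iH^{(1)}_m(z)$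 and $iH^{(2)}_m(z)$, respectively. (iv) For $m\in\mathbb Z$ the following integrals converge absolutely and $$H^{(1)}_m(z)=\frac{2i^{m-1}}{\pi}\left[\frac1\pi\int_0^\pi e^{-iz\cos\theta}\,\Gamma(0,-iz(1+\cos\theta))\cos m\theta\,d\theta+\sigma_m(z)\right],$$ $$H^{(2)}_m(z)=-\frac{2i^{m-1}}{\pi}\left[\frac1\pi\int_0^\pi e^{-iz\cos\theta}\left[\Gamma(0,-iz(1+\cos\theta))-i\pi\right]\cos m\theta\,d\theta+\sigma_m(z)\right].$$ -/

import Mathlib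

open Filter Topology MeasureTheory

noncomputable section

namespace Cylinder

/-- The Bessel function of the first kind,
`(z/2)^μ ∑ (-1)^k (z/2)^(2k) / (k! Γ(μ+k+1))`, with the principal power and with `1/Γ = 0` at the
poles of `Γ` (in Lean `Γ = 0` and `0⁻¹ = 0` there). -/
def besselJ (μ z : ℂ) : ℂ :=
  (z / 2) ^ μ * ∑' k : ℕ, (-1) ^ k * (z / 2) ^ (2 * k) *
    ((k.factorial : ℂ) * Complex.Gamma (μ + k + 1))⁻¹

/-- The quotient that defines the Bessel function of the second kind at non-integral order. -/
def neumannQuotient (μ z : ℂ) : ℂ :=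
  (besselJ μ z * Complex.cos (μ * Real.pi) - besselJ (-μ) z) / Complex.sin (μ * Real.pi)

open Classical in
/-- The Bessel function of the second kind; at integral order it is the limit in the order. -/
def besselY (μ z : ℂ) : ℂ :=
  if ∃ m : ℤ, μ = m then limUnder (𝓝[≠] μ) (fun ν => neumannQuotient ν z)
  else neumannQuotient μ z

/-- The Hankel function of the first kind. -/
def hankel₁ (μ z : ℂ) : ℂ := besselJ μ z + Complex.I * besselY μ z

/-- The Hankel function of the second kind. -/
def hankel₂ (μ z : ℂ) : ℂ := besselJ μ z - Complex.I * besselY μ z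

/-- The nearest integer of a real number, with `n + 1/2` rounded to `n`. -/
def nearestInt (x : ℝ) : ℤ := ⌈x - 1 / 2⌉

/-- The complex fractional part, whose real part lies in `(-1/2, 1/2]`. -/
def fracPart (μ : ℂ) : ℂ := μ - nearestInt μ.re

open Classical in
/-- Tricomi's entire function `γ*`, for which `P(ν, w) = w^ν γ*(ν, w)`. -/
def gammaStar (ν w : ℂ) : ℂ :=
  if ∃ n : ℕ, ν = -(n : ℂ) then w ^ (-ν)
  else (Complex.Gamma ν)⁻¹ * ∑' m : ℕ, (-w) ^ m / ((ν + m) * (m.factorial : ℂ))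

/-- The normalised lower incomplete gamma function `P(ν, w) = w^ν γ*(ν, w)` at the point
`w = exp s` of the Riemann surface of the logarithm, where `s` is the chosen value of `log w`. -/
def normGammaP (ν s : ℂ) : ℂ := Complex.exp (ν * s) * gammaStar ν (Complex.exp s)

/-- The upper incomplete gamma function `Γ(a, w) = ∫_w^∞ t^(a-1) e^(-t) dt` at the point
`w = exp s` of the Riemann surface of the logarithm. The substitution `t = exp σ` turns it into the
integral of `exp (a σ - exp σ)` along the path that goes from `s` straight to `0` and then along
the positive real half-line. -/
def upperGamma (a s : ℂ) : ℂ :=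
  (∫ σ in Set.Ioi (0 : ℝ), Complex.exp (a * σ - Complex.exp σ)) -
    s * ∫ τ in (0 : ℝ)..1, Complex.exp (a * (τ * s) - Complex.exp (τ * s))

/-- The logarithm of `-i z`, with `arg (-i z) = arg z - π/2`. -/
def logNegI (z : ℂ) : ℂ := Complex.log z - Complex.I * (Real.pi / 2)

/-- The logarithm of `-i z (1 + cos θ)`, with argument `arg z - π/2`. (The endpoint `θ = π`, where
`1 + cos θ = 0`, plays no role in the integrals below.) -/
def logArg (z : ℂ) (θ : ℝ) : ℂ := logNegI z + (Real.log (1 + Real.cos θ) : ℝ)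

/-- The integrand of the integral term `B`. -/
def integrandB (μ z : ℂ) (θ : ℝ) : ℂ :=
  Complex.exp (-Complex.I * z * Real.cos θ) * normGammaP (fracPart μ) (logArg z θ) *
    Complex.cos (μ * θ)

/-- The integral term `B_μ(z)`. -/
def B (μ z : ℂ) : ℂ :=
  Complex.I ^ μ / Real.pi * ∫ θ in (0 : ℝ)..Real.pi, integrandB μ z θ

open Classical in
/-- The quotient `Γ(j+μ-1/2) / Γ(j+2μ)`. At a negative half-integer `μ = m + 1/2`, where for
`1 ≤ j ≤ -m` both gamma functions have a pole, it is replaced by its limit. -/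
def gammaQuotient (μ : ℂ) (j : ℕ) : ℂ :=
  if ∃ m : ℤ, m ≤ -1 ∧ μ = m + 1 / 2 then
    2 * (-1) ^ (nearestInt μ.re + 1) * Complex.Gamma (-j - 2 * (nearestInt μ.re : ℂ)) /
      Complex.Gamma (-j - (nearestInt μ.re : ℂ) + 1)
  else Complex.Gamma (j + μ - 1 / 2) / Complex.Gamma (j + 2 * μ)

/-- The corrective term `χ_μ(z)`; the power `(-2 i z)^(j+μ-1)` is taken with
`arg (-2 i z) = arg z - π/2`. -/
def chi (μ z : ℂ) : ℂ :=
  if μ.re ≤ -1 / 2 then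
    Complex.I ^ μ / (Real.sqrt Real.pi : ℝ) * Complex.exp (Complex.I * z) *
      ∑ j ∈ Finset.Icc 1 (-nearestInt μ.re).toNat,
        gammaQuotient μ j / Complex.Gamma j *
          Complex.exp ((j + μ - 1) * ((Real.log 2 : ℝ) + logNegI z))
  else 0

/-- The integral term for the first Hankel function. -/
def calH₁ (μ z : ℂ) : ℂ :=
  (Complex.exp (-Complex.I * μ * Real.pi) * B μ z - B (-μ) z) / Complex.sin (μ * Real.pi)

/-- The integral term for the second Hankel function. -/
def calH₂ (μ z : ℂ) : ℂ :=
  (Complex.exp (Complex.I * μ * Real.pi) * B μ z - B (-μ) z) / Complex.sin (μ * Real.pi)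

/-- The factor `T_-(μ)`. -/
def Tminus (μ : ℂ) : ℂ := if μ.re < 0 then Complex.exp (-Complex.I * μ * Real.pi) else -1

/-- The factor `T_+(μ)`. -/
def Tplus (μ : ℂ) : ℂ := if μ.re < 0 then Complex.exp (Complex.I * μ * Real.pi) else -1

/-- The integral-plus-sum expression for `-i` times the first Hankel function. -/
def mixed₁ (μ z : ℂ) : ℂ :=
  calH₁ μ z + Tminus μ * (chi (-μ * (Real.sign μ.re : ℝ)) z / Complex.sin (μ * Real.pi))

/-- The integral-plus-sum expression for `i` times the second Hankel function. -/
def mixed₂ (μ z : ℂ) : ℂ :=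
  calH₂ μ z + Tplus μ * (chi (-μ * (Real.sign μ.re : ℝ)) z / Complex.sin (μ * Real.pi))

/-- The finite sum `σ_m(z)` of the integral-order representations. -/
def sigma (m : ℤ) (z : ℂ) : ℂ :=
  (-1) ^ m / (Real.sqrt Real.pi : ℝ) * Complex.exp (Complex.I * z) *
    ∑ j ∈ Finset.Icc 1 m.natAbs,
      Complex.Gamma (1 / 2 - j) * Complex.Gamma (j + m.natAbs) / Complex.Gamma (m.natAbs - j + 1) *
        (2 * Complex.I * z) ^ (-(j : ℤ))

end Cylinder

end

noncomputable section

/-! Everything rests on the identity `J_μ = B_μ + χ_μ` (`besselJ_eq_B_add_chi`), valid for all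
complex orders. Put `ν = {μ}`, `n = ⟨Re μ⟩` and `w = -iz(1 + cos θ)`. Since `e^w γ*(ν, w) = ∑ w^k /
Γ(ν+k+1)` and `e^{-iz cos θ} = e^{iz} e^w`, the integrand of `B_μ` is `e^{iz} cos μθ ∑ w^{ν+k} /
Γ(ν+k+1)`. Integrated term by term it gives Cauchy integrals of `(1 + cos θ)^{ν+k} cos μθ`. Up to
elementary factors these are the Fourier coefficients of `(1+u)^{2(ν+k)}` on the unit circle with
index `l = k - n`: the binomial coefficients of `2(ν+k)` over `l`, and zero for `l < 0`
(`hasSum_integral_normGammaP`, `fourierBinom_natCast`, `fourierBinom_neg`).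

On the other side, Kummer's transformation writes `J_μ` as `(z/2)^μ e^{iz} ∑_l c_l (-iz/2)^l`, where
`c_l` is the binomial coefficient of `2(μ+l)` over `l`, divided by `Γ(μ+l+1)` (`besselJ_eq`). The
term `k` of `B_μ` is the term `l = k - n` of this series. As `k ≥ 0`, all `l ≥ 0` occur if `n ≥ 0`;
if `n < 0` the terms `l < -n` are missing, and by the duplication formula they add up to `χ_μ`
(`kummerCoeff_eq_gammaQuotient`).

At non-integral order the Hankel functions are combinations of `J_μ` and `J_{-μ}`, and at most one
of `χ_μ`, `χ_{-μ}` is nonzero; this yields the mixed representations. Their limits at integers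
follow from the continuity of `J` and `Y` in the order.

For the explicit formulas at an integer the limit is computed a second time. Because `P(ν, w) = 1 -
Γ(ν, w)/Γ(ν)` for `Re ν > 0`, the derivative of `P` in `ν` at `0` is `-Γ(0, w)`
(`hasDerivAt_normGammaP_left_zero`). Hence `(P(ε, w) - P(-ε, w))/ε → -2Γ(0, w)`, and a Cauchy
estimate in `ν` dominates the integrands (`tendsto_calH₁`). In the correction, the zero of `1/Γ(j -
2μ)` cancels that of `sin μπ` by reflection (`tendsto_chi_div_sin`). Negative orders follow from
`H_{-m} = (-1)^m H_m`, and the second Hankel function from `H^{(2)} = 2J - H^{(1)}` with Bessel's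
integral. -/

namespace Cylinder

/-! ### Series in reciprocal gamma functions -/

/-- The reciprocal gamma functions `1 / Γ(ν + k + 1)` decay like `2 ^ k / k!`, locally uniformly
in `ν`. -/
theorem exists_norm_inv_Gamma_le (R : ℝ) : ∃ C : ℝ, 0 ≤ C ∧ ∀ ν : ℂ, ‖ν‖ ≤ R → ∀ k : ℕ,
    ‖(Complex.Gamma (ν + k + 1))⁻¹‖ ≤ C * (2 ^ k / k.factorial) := by
  have hcont (k : ℕ) : Continuous fun ν : ℂ => (Complex.Gamma (ν + k + 1))⁻¹ :=
    Complex.differentiable_one_div_Gamma.continuous.comp (by fun_prop)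
  have hb (k : ℕ) : ∃ M : ℝ, 0 ≤ M ∧ ∀ ν : ℂ, ‖ν‖ ≤ R → ‖(Complex.Gamma (ν + k + 1))⁻¹‖ ≤ M := by
    obtain ⟨M, hM⟩ := (isCompact_closedBall (0 : ℂ) R).exists_bound_of_continuousOn
      (hcont k).continuousOn
    exact ⟨max M 0, le_max_right _ _, fun ν hν =>
      (hM ν (mem_closedBall_zero_iff.2 hν)).trans (le_max_left _ _)⟩
  choose M hM0 hM using hb
  -- For `k ≥ K ≥ 2R` one has `‖ν + k + 1‖ ≥ k + 1 - R ≥ (k+1)/2`, so each step of the recurrence of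
  -- `1/Γ` gains a factor at most `2/(k+1)`, the ratio of consecutive `2^k / k!`. The finitely many
  -- `k ≤ K` are absorbed in `C` by compactness.
  obtain ⟨K, hK⟩ := exists_nat_ge (2 * R)
  have hpos (k : ℕ) : (0 : ℝ) < 2 ^ k / k.factorial := by positivity
  set C := ∑ k ∈ Finset.range (K + 1), M k / (2 ^ k / k.factorial) with hC
  have hterm (k : ℕ) : 0 ≤ M k / (2 ^ k / k.factorial) := div_nonneg (hM0 k) (hpos k).le
  have hC0 : 0 ≤ C := Finset.sum_nonneg fun k _ => hterm k
  have hsmall (k : ℕ) (hk : k ≤ K) (ν : ℂ) (hν : ‖ν‖ ≤ R) :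
      ‖(Complex.Gamma (ν + k + 1))⁻¹‖ ≤ C * (2 ^ k / k.factorial) := by
    refine (hM k ν hν).trans ?_
    rw [← div_le_iff₀ (hpos k)]
    exact Finset.single_le_sum (f := fun k : ℕ => M k / (2 ^ k / k.factorial))
      (fun i _ => hterm i) (Finset.mem_range.2 (Nat.lt_succ_of_le hk))
  refine ⟨C, hC0, fun ν hν k => ?_⟩
  rcases le_total k K with hk | hk
  · exact hsmall k hk ν hν
  · induction k, hk using Nat.le_induction with
    | base => exact hsmall K le_rfl ν hν
    | succ k hk ih =>
      have h1 : ((k : ℝ) + 1) / 2 ≤ ‖ν + k + 1‖ := by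
        have h2 : ‖((k : ℂ) + 1)‖ ≤ ‖ν + k + 1‖ + ‖ν‖ := by
          have := norm_sub_le (ν + k + 1) ν
          rwa [show ν + k + 1 - ν = (k : ℂ) + 1 by ring] at this
        have h3 : ‖((k : ℂ) + 1)‖ = k + 1 := by
          rw [← Nat.cast_succ, Complex.norm_natCast]; simp
        have h4 : (K : ℝ) ≤ k := by exact_mod_cast hk
        linarith
      have hk0 : (0 : ℝ) < ((k : ℝ) + 1) / 2 := by positivity
      have hne : ν + k + 1 ≠ 0 := norm_pos_iff.1 (hk0.trans_le h1)
      have h5 := Complex.one_div_Gamma_eq_self_mul_one_div_Gamma_add_one (ν + k + 1)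
      have h6 : (Complex.Gamma (ν + (k + 1 : ℕ) + 1))⁻¹ =
          (Complex.Gamma (ν + k + 1))⁻¹ / (ν + k + 1) := by
        rw [h5]; push_cast; rw [← add_assoc]; field_simp
      rw [h6, norm_div]
      calc _ ≤ C * (2 ^ k / k.factorial) / (((k : ℝ) + 1) / 2) := by gcongr
        _ = _ := by
          rw [Nat.factorial_succ, pow_succ]; push_cast; field_simp

/-- By Weierstrass' theorem: on each ball the entire terms are dominated by a summable sequence. It
supplies analyticity in the order both for the Bessel and for the incomplete gamma function. -/
theorem differentiable_tsum_inv_Gamma {a : ℕ → ℂ}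
    (ha : Summable fun k => ‖a k‖ * (2 ^ k / k.factorial)) :
    Differentiable ℂ fun ν : ℂ => ∑' k : ℕ, a k * (Complex.Gamma (ν + k + 1))⁻¹ := by
  intro ν
  obtain ⟨C, -, hC⟩ := exists_norm_inv_Gamma_le (‖ν‖ + 1)
  have hmem : ν ∈ Metric.ball (0 : ℂ) (‖ν‖ + 1) := by simp
  refine DifferentiableOn.differentiableAt (s := Metric.ball (0 : ℂ) (‖ν‖ + 1)) ?_
    (Metric.isOpen_ball.mem_nhds hmem)
  refine Complex.differentiableOn_tsum_of_summable_norm (ha.mul_left C) (fun k => ?_)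
    Metric.isOpen_ball fun k w hw => ?_
  · refine ((Complex.differentiable_one_div_Gamma.comp ?_).const_mul (a k)).differentiableOn
    fun_prop
  · rw [norm_mul, mul_left_comm]
    gcongr
    exact hC w (mem_ball_zero_iff.1 hw).le k

theorem summable_norm_pow_mul_factorial (w : ℂ) :
    Summable fun k : ℕ => ‖w ^ k‖ * (2 ^ k / k.factorial) := by
  refine (Real.summable_pow_div_factorial (‖w‖ * 2)).congr fun k => ?_
  rw [norm_pow, mul_pow, mul_div_assoc]

/-- The series `∑ w^k / Γ(ν+k+1)`, which equals `exp w * γ*(ν, w)`. -/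
def rgSeries (ν w : ℂ) : ℂ := ∑' k : ℕ, w ^ k * (Complex.Gamma (ν + k + 1))⁻¹

theorem differentiable_rgSeries_left (w : ℂ) : Differentiable ℂ fun ν => rgSeries ν w :=
  differentiable_tsum_inv_Gamma (summable_norm_pow_mul_factorial w)

theorem summable_norm_rgSeries (ν w : ℂ) :
    Summable fun k : ℕ => ‖w ^ k * (Complex.Gamma (ν + k + 1))⁻¹‖ := by
  obtain ⟨C, -, hC⟩ := exists_norm_inv_Gamma_le ‖ν‖
  refine Summable.of_nonneg_of_le (fun _ => norm_nonneg _) (fun k => ?_)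
    ((summable_norm_pow_mul_factorial w).mul_left C)
  rw [norm_mul, mul_left_comm]
  gcongr
  exact hC ν le_rfl k

theorem exists_norm_rgSeries_le (R r : ℝ) : ∃ C : ℝ, 0 ≤ C ∧ ∀ ν w : ℂ, ‖ν‖ ≤ R → ‖w‖ ≤ r →
    ‖rgSeries ν w‖ ≤ C := by
  obtain ⟨C, hC0, hC⟩ := exists_norm_inv_Gamma_le R
  have hs : Summable fun k : ℕ => C * (‖(r : ℂ) ^ k‖ * (2 ^ k / k.factorial)) :=
    (summable_norm_pow_mul_factorial (r : ℂ)).mul_left C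
  refine ⟨_, tsum_nonneg fun k => by positivity, fun ν w hν hw => tsum_of_norm_bounded hs.hasSum fun k => ?_⟩
  rw [norm_mul, mul_left_comm, norm_pow, norm_pow]
  have h1 : ‖w‖ ≤ ‖(r : ℂ)‖ := by
    rw [Complex.norm_real]; exact hw.trans (le_abs_self r)
  gcongr
  exact hC ν hν k

theorem differentiable_rgSeries_right (ν : ℂ) : Differentiable ℂ fun w => rgSeries ν w := by
  intro w
  obtain ⟨C, -, hC⟩ := exists_norm_inv_Gamma_le ‖ν‖
  have hmem : w ∈ Metric.ball (0 : ℂ) (‖w‖ + 1) := by simp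
  refine DifferentiableOn.differentiableAt (s := Metric.ball (0 : ℂ) (‖w‖ + 1)) ?_
    (Metric.isOpen_ball.mem_nhds hmem)
  refine Complex.differentiableOn_tsum_of_summable_norm
    ((summable_norm_pow_mul_factorial ((‖w‖ + 1 : ℝ) : ℂ)).mul_left C) (fun k => ?_)
    Metric.isOpen_ball fun k y hy => ?_
  · exact ((differentiable_id.pow k).mul_const _).differentiableOn
  · rw [norm_mul, mul_left_comm, norm_pow, norm_pow]
    have h1 : ‖y‖ ≤ ‖((‖w‖ + 1 : ℝ) : ℂ)‖ := by
      rw [Complex.norm_real]; exact (mem_ball_zero_iff.1 hy).le.trans (le_abs_self _)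
    gcongr
    exact hC ν le_rfl k

/-- The Bessel function is entire in its order. -/
theorem differentiable_besselJ {z : ℂ} (hz : z ≠ 0) : Differentiable ℂ fun μ => besselJ μ z := by
  have h1 : Differentiable ℂ fun μ : ℂ => (z / 2) ^ μ := fun μ =>
    differentiableAt_id.const_cpow (Or.inl (by simpa using hz))
  have hs : Summable fun k : ℕ =>
      ‖(-1) ^ k * (z / 2) ^ (2 * k) * ((k.factorial : ℂ))⁻¹‖ * (2 ^ k / k.factorial) := by
    refine Summable.of_nonneg_of_le (fun k => by positivity) (fun k => ?_)
      (summable_norm_pow_mul_factorial ((z / 2) ^ 2))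
    gcongr
    rw [norm_mul, norm_mul, norm_pow, norm_neg, norm_one, one_pow, one_mul, ← pow_mul, norm_inv,
      Complex.norm_natCast]
    refine mul_le_of_le_one_right (norm_nonneg _) (inv_le_one_of_one_le₀ ?_)
    exact_mod_cast k.factorial_pos
  have h2 : (fun μ : ℂ => ∑' k : ℕ, (-1) ^ k * (z / 2) ^ (2 * k) *
      ((k.factorial : ℂ) * Complex.Gamma (μ + k + 1))⁻¹) = fun μ => ∑' k : ℕ,
      (-1) ^ k * (z / 2) ^ (2 * k) * ((k.factorial : ℂ))⁻¹ * (Complex.Gamma (μ + k + 1))⁻¹ := by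
    simp only [mul_inv, mul_assoc]
  refine h1.mul ?_
  rw [h2]
  exact differentiable_tsum_inv_Gamma hs

/-! ### Powers of `1 + cos θ` and Fourier coefficients of `(1 + u) ^ b` -/

theorem one_add_cos_pos {θ : ℝ} (h : θ ∈ Set.Ioo (-Real.pi) Real.pi) : 0 < 1 + Real.cos θ := by
  have h1 : 0 < Real.cos (θ / 2) :=
    Real.cos_pos_of_mem_Ioo ⟨by linarith [h.1], by linarith [h.2]⟩
  have h2 : Real.cos θ = 2 * Real.cos (θ / 2) ^ 2 - 1 := by
    rw [← Real.cos_two_mul]; congr 1; ring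
  rw [h2]
  nlinarith

/-- Near `θ = π` the function `1 + cos θ` has a double zero, so its power `c` is integrable when `2c
> -1`. This is why the fractional part is normalised by `Re {μ} > -1/2`. -/
theorem intervalIntegrable_exp_mul_log_one_add_cos {c : ℝ} (hc : -1 / 2 < c) :
    IntervalIntegrable (fun θ => Real.exp (c * Real.log (1 + Real.cos θ))) volume 0 Real.pi := by
  have hmeas : AEStronglyMeasurable (fun θ => Real.exp (c * Real.log (1 + Real.cos θ)))
      (volume.restrict (Set.uIoc 0 Real.pi)) := by
    apply Measurable.aestronglyMeasurable; fun_prop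
  rcases le_or_gt 0 c with h0 | h0
  · refine (intervalIntegrable_const (c := Real.exp (c * Real.log 2))).mono_fun' hmeas
      (Eventually.of_forall fun θ => ?_)
    dsimp only
    rw [Real.norm_eq_abs, Real.abs_exp]
    refine Real.exp_le_exp.2 (mul_le_mul_of_nonneg_left ?_ h0)
    rcases (show 0 ≤ 1 + Real.cos θ by linarith [Real.neg_one_le_cos θ]).eq_or_lt with h | h
    -- Where `1 + cos θ = 0`, Lean's `Real.log 0 = 0` still lies below `log 2`.
    · rw [← h, Real.log_zero]; exact Real.log_nonneg (by norm_num)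
    · exact Real.log_le_log h (by linarith [Real.cos_le_one θ])
  · have h1 : IntervalIntegrable (fun x : ℝ => Real.exp (c * Real.log 2) *
        (Real.pi ^ (-(2 * c)) * (Real.pi - x) ^ (2 * c))) volume 0 Real.pi := by
      have h2 := (intervalIntegral.intervalIntegrable_rpow' (a := 0) (b := Real.pi)
        (r := 2 * c) (by linarith)).comp_sub_left Real.pi
      simp only [sub_zero, sub_self] at h2
      exact (h2.symm.const_mul _).const_mul _
    refine h1.mono_fun' hmeas ?_
    rw [Set.uIoc_of_le Real.pi_pos.le, ← restrict_Ioo_eq_restrict_Ioc]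
    refine (ae_restrict_mem measurableSet_Ioo).mono fun θ hθ => ?_
    have hpt : 0 < Real.pi - θ := by linarith [hθ.2]
    have hpi := Real.pi_pos
    -- Jordan's inequality `sin x ≥ 2x/π` at `x = (π - θ)/2`.
    have h3 : (Real.pi - θ) / Real.pi ≤ Real.cos (θ / 2) := by
      have := Real.mul_le_sin (x := (Real.pi - θ) / 2) (by linarith) (by linarith [hθ.1])
      rw [show (Real.pi - θ) / 2 = Real.pi / 2 - θ / 2 by ring, Real.sin_pi_div_two_sub] at this
      refine le_trans (le_of_eq ?_) this
      field_simp
    have hq : 0 < (Real.pi - θ) / Real.pi := by positivity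
    have h4 : 2 * ((Real.pi - θ) / Real.pi) ^ 2 ≤ 1 + Real.cos θ := by
      have h2 : Real.cos θ = 2 * Real.cos (θ / 2) ^ 2 - 1 := by
        rw [← Real.cos_two_mul]; congr 1; ring
      rw [h2]
      nlinarith
    have h5 : Real.log 2 + 2 * (Real.log (Real.pi - θ) - Real.log Real.pi) ≤
        Real.log (1 + Real.cos θ) := by
      refine le_trans (le_of_eq ?_) (Real.log_le_log (by positivity) h4)
      rw [Real.log_mul (by norm_num) (by positivity), Real.log_pow,
        Real.log_div hpt.ne' hpi.ne']
      norm_num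
    dsimp only
    rw [Real.norm_eq_abs, Real.abs_exp, Real.rpow_def_of_pos hpt, Real.rpow_def_of_pos hpi,
      ← Real.exp_add, ← Real.exp_add]
    gcongr
    nlinarith

/-- This is `1 + e^{iθ} = 2 cos(θ/2) e^{iθ/2}`, with the modulus rewritten through `2(1 + cos θ) =
(2 cos(θ/2))²`. The angle `θ/2` is within the principal range, so it also identifies the logarithm.
-/
theorem one_add_exp_eq {θ : ℝ} (h : θ ∈ Set.Ioo (-Real.pi) Real.pi) :
    1 + Complex.exp (θ * Complex.I) =
      Complex.exp ((Real.log (2 * (1 + Real.cos θ)) / 2 : ℝ) + (θ / 2 : ℝ) * Complex.I) := by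
  have h1 : 0 < Real.cos (θ / 2) :=
    Real.cos_pos_of_mem_Ioo ⟨by linarith [h.1], by linarith [h.2]⟩
  have h2 : Real.cos θ = 2 * Real.cos (θ / 2) ^ 2 - 1 := by
    rw [← Real.cos_two_mul]; congr 1; ring
  have h2s : Real.sin θ = 2 * Real.sin (θ / 2) * Real.cos (θ / 2) := by
    rw [← Real.sin_two_mul]; congr 1; ring
  have h3 : Real.log (2 * (1 + Real.cos θ)) / 2 = Real.log (2 * Real.cos (θ / 2)) := by
    rw [show 2 * (1 + Real.cos θ) = (2 * Real.cos (θ / 2)) ^ 2 by rw [h2]; ring, Real.log_pow]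
    push_cast; ring
  rw [h3, Complex.exp_add, ← Complex.ofReal_exp, Real.exp_log (by linarith),
    Complex.exp_mul_I, Complex.exp_mul_I, ← Complex.ofReal_cos, ← Complex.ofReal_sin,
    ← Complex.ofReal_cos, ← Complex.ofReal_sin, h2, h2s]
  push_cast
  ring

theorem log_one_add_exp {θ : ℝ} (h : θ ∈ Set.Ioo (-Real.pi) Real.pi) :
    Complex.log (1 + Complex.exp (θ * Complex.I)) =
      (Real.log (2 * (1 + Real.cos θ)) / 2 : ℝ) + (θ / 2 : ℝ) * Complex.I := by
  rw [one_add_exp_eq h, Complex.log_exp]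
  · simp; linarith [h.1, Real.pi_pos]
  · simp; linarith [h.2, Real.pi_pos]

theorem one_add_exp_mem_slitPlane {θ : ℝ} (h : θ ∈ Set.Ioo (-Real.pi) Real.pi) :
    1 + Complex.exp (θ * Complex.I) ∈ Complex.slitPlane := by
  left
  rw [Complex.add_re, Complex.exp_ofReal_mul_I_re, Complex.one_re]
  exact one_add_cos_pos h

theorem one_add_exp_cpow {θ : ℝ} (h : θ ∈ Set.Ioo (-Real.pi) Real.pi) (b : ℂ) :
    (1 + Complex.exp (θ * Complex.I)) ^ b =
      Complex.exp (b / 2 * Real.log 2) * Complex.exp (b / 2 * Real.log (1 + Real.cos θ)) *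
        Complex.exp (b / 2 * θ * Complex.I) := by
  rw [Complex.cpow_def_of_ne_zero (Complex.slitPlane_ne_zero (one_add_exp_mem_slitPlane h)),
    log_one_add_exp h, Real.log_mul (by norm_num) (one_add_cos_pos h).ne', ← Complex.exp_add,
    ← Complex.exp_add]
  congr 1
  push_cast
  ring

theorem intervalIntegrable_one_add_exp_cpow {b : ℂ} (hb : -1 < b.re) (l : ℤ) :
    IntervalIntegrable (fun θ : ℝ => (1 + Complex.exp (θ * Complex.I)) ^ b *
      Complex.exp (-(l * θ * Complex.I))) volume (-Real.pi) Real.pi := by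
  have h1 := intervalIntegrable_exp_mul_log_one_add_cos (c := b.re / 2) (by linarith)
  have h2 : IntervalIntegrable (fun θ => Real.exp (b.re / 2 * Real.log (1 + Real.cos θ))) volume
      (-Real.pi) Real.pi := by
    have h3 := h1.comp_mul_left (c := -1)
    simp only [neg_one_mul, Real.cos_neg, div_neg, div_one, neg_zero] at h3
    exact h3.symm.trans h1
  have hmeas : Measurable fun θ : ℝ => (1 + Complex.exp (θ * Complex.I)) ^ b *
      Complex.exp (-(l * θ * Complex.I)) := by
    refine Measurable.mul (Measurable.pow_const ?_ b) ?_ <;> fun_prop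
  refine (h2.const_mul (Real.exp (|b.re / 2| * Real.log 2 + |b.im| * Real.pi))).mono_fun'
    hmeas.aestronglyMeasurable ?_
  rw [Set.uIoc_of_le (by linarith [Real.pi_pos]), ← restrict_Ioo_eq_restrict_Ioc]
  refine (ae_restrict_mem measurableSet_Ioo).mono fun θ hθ => ?_
  have h4 : ‖Complex.exp (-(l * θ * Complex.I))‖ = 1 := by
    rw [Complex.norm_exp]; simp
  dsimp only
  rw [one_add_exp_cpow hθ, norm_mul, h4, mul_one, ← Complex.exp_add, ← Complex.exp_add,
    Complex.norm_exp, ← Real.exp_add]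
  gcongr
  have h5 : (b / 2 * (Real.log 2 : ℝ) + b / 2 * (Real.log (1 + Real.cos θ) : ℝ) +
      b / 2 * θ * Complex.I).re = b.re / 2 * Real.log 2 +
        b.re / 2 * Real.log (1 + Real.cos θ) - b.im / 2 * θ := by
    simp only [Complex.add_re, Complex.mul_re, Complex.ofReal_re, Complex.ofReal_im,
      Complex.I_re, Complex.I_im, Complex.mul_im, Complex.div_ofNat_re, Complex.div_ofNat_im]
    ring
  rw [h5]
  have h6 : b.re / 2 * Real.log 2 ≤ |b.re / 2| * Real.log 2 :=
    mul_le_mul_of_nonneg_right (le_abs_self _) (Real.log_nonneg (by norm_num))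
  have h7 : -(b.im / 2 * θ) ≤ |b.im| * Real.pi := by
    refine (neg_le_abs _).trans ?_
    rw [abs_mul]
    have : |θ| ≤ Real.pi := abs_le.2 ⟨hθ.1.le, hθ.2.le⟩
    have h8 : |b.im / 2| ≤ |b.im| := by
      rw [abs_div, abs_two]; linarith [abs_nonneg b.im]
    gcongr
  linarith

/-- The Fourier coefficient of `(1 + u) ^ b` on the unit circle. -/
def fourierBinom (b : ℂ) (l : ℤ) : ℂ :=
  ∫ θ in (-Real.pi)..Real.pi, (1 + Complex.exp (θ * Complex.I)) ^ b *
    Complex.exp (-(l * θ * Complex.I))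

/-- Pascal's rule, from `(1+u)^{b+1} = (1+u)^b + u (1+u)^b`. -/
theorem fourierBinom_add_one {b : ℂ} (hb : -1 < b.re) (l : ℤ) :
    fourierBinom (b + 1) l = fourierBinom b l + fourierBinom b (l - 1) := by
  rw [fourierBinom, fourierBinom, fourierBinom, ← intervalIntegral.integral_add
    (intervalIntegrable_one_add_exp_cpow hb l) (intervalIntegrable_one_add_exp_cpow hb (l - 1))]
  refine intervalIntegral.integral_congr_ae ?_
  have h0 : ∀ᵐ θ : ℝ ∂volume, θ ≠ Real.pi := by
    simp [ae_iff]
  filter_upwards [h0] with θ hθ hmem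
  rw [Set.uIoc_of_le (by linarith [Real.pi_pos])] at hmem
  have hmem' : θ ∈ Set.Ioo (-Real.pi) Real.pi := ⟨hmem.1, lt_of_le_of_ne hmem.2 hθ⟩
  have hne := Complex.slitPlane_ne_zero (one_add_exp_mem_slitPlane hmem')
  rw [Complex.cpow_add _ _ hne, Complex.cpow_one]
  have h1 : Complex.exp (-((l - 1 : ℤ) * θ * Complex.I)) =
      Complex.exp (θ * Complex.I) * Complex.exp (-(l * θ * Complex.I)) := by
    rw [← Complex.exp_add]; congr 1; push_cast; ring
  rw [h1]
  ring

/-- Integration by parts over the circle; for `Re b > 0` the function `(1+u)^b` is continuous and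
vanishes at the branch point `u = -1`, so there are no boundary terms. -/
theorem mul_fourierBinom {b : ℂ} (hb : 0 < b.re) (l : ℤ) :
    l * fourierBinom b l = b * fourierBinom (b - 1) (l - 1) := by
  have hb0 : b ≠ 0 := by rintro rfl; simp at hb
  have hcont : Continuous fun θ : ℝ => (1 + Complex.exp (θ * Complex.I)) ^ b := by
    rw [continuous_iff_continuousAt]
    intro θ
    have h1 : ContinuousAt (fun x : ℂ => x ^ b) (1 + Complex.exp (θ * Complex.I)) := by
      refine Complex.continuousAt_cpow_const_of_re_pos (Or.inl ?_) hb
      rw [Complex.add_re, Complex.exp_ofReal_mul_I_re, Complex.one_re]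
      linarith [Real.neg_one_le_cos θ]
    exact ContinuousAt.comp (f := fun θ : ℝ => 1 + Complex.exp (θ * Complex.I)) h1 (by fun_prop)
  have hint1 := intervalIntegrable_one_add_exp_cpow (b := b) (by linarith) l
  have hint2 := intervalIntegrable_one_add_exp_cpow (b := b - 1) (by simpa using hb) (l - 1)
  have key := intervalIntegral.integral_eq_sub_of_hasDerivAt_of_le
    (a := -Real.pi) (b := Real.pi)
    (f := fun θ : ℝ => (1 + Complex.exp (θ * Complex.I)) ^ b * Complex.exp (-(l * θ * Complex.I)))
    (f' := fun θ : ℝ => Complex.I * b * ((1 + Complex.exp (θ * Complex.I)) ^ (b - 1) *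
        Complex.exp (-((l - 1 : ℤ) * θ * Complex.I))) -
      Complex.I * l * ((1 + Complex.exp (θ * Complex.I)) ^ b *
        Complex.exp (-(l * θ * Complex.I))))
    (by linarith [Real.pi_pos]) ((hcont.mul (by fun_prop)).continuousOn)
    (fun θ hθ => ?_) ((hint2.const_mul _).sub (hint1.const_mul _))
  · rw [intervalIntegral.integral_sub (hint2.const_mul _) (hint1.const_mul _),
      intervalIntegral.integral_const_mul, intervalIntegral.integral_const_mul] at key
    have hz : (1 : ℂ) + Complex.exp ((Real.pi : ℝ) * Complex.I) = 0 := by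
      rw [Complex.exp_pi_mul_I]; ring
    have hz' : (1 : ℂ) + Complex.exp ((-Real.pi : ℝ) * Complex.I) = 0 := by
      rw [Complex.ofReal_neg, neg_mul, Complex.exp_neg, Complex.exp_pi_mul_I]; norm_num
    rw [hz, hz', Complex.zero_cpow hb0, zero_mul, zero_mul, sub_zero] at key
    have h2 : Complex.I * (b * fourierBinom (b - 1) (l - 1) - l * fourierBinom b l) = 0 := by
      rw [← key, fourierBinom, fourierBinom]; ring
    exact (sub_eq_zero.1 ((mul_eq_zero.1 h2).resolve_left Complex.I_ne_zero)).symm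
  · have hs := one_add_exp_mem_slitPlane hθ
    have h1 : HasDerivAt (fun w : ℂ => 1 + Complex.exp (w * Complex.I))
        (Complex.exp (θ * Complex.I) * Complex.I) θ := by
      simpa using ((hasDerivAt_id (θ : ℂ)).mul_const Complex.I).cexp.const_add (1 : ℂ)
    have h2 : HasDerivAt (fun θ : ℝ => Complex.exp (-(l * θ * Complex.I)))
        (Complex.exp (-(l * θ * Complex.I)) * (-(l * Complex.I))) θ := by
      have := (((Complex.ofRealCLM.hasDerivAt (x := θ)).const_mul (l : ℂ)).mul_const
        Complex.I).neg.cexp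
      simpa using this
    have h3 := (HasDerivAt.cpow_const (c := b) h1 hs).comp_ofReal.mul h2
    refine h3.congr_deriv ?_
    have h4 : Complex.exp (-((l - 1 : ℤ) * θ * Complex.I)) =
        Complex.exp (θ * Complex.I) * Complex.exp (-(l * θ * Complex.I)) := by
      rw [← Complex.exp_add]; congr 1; push_cast; ring
    rw [h4]
    ring

/-- Cauchy's formula at the centre of the unit disc; `Re b > 0` ensures continuity up to the
boundary point `-1`. -/
theorem fourierBinom_zero_of_re_pos {b : ℂ} (hb : 0 < b.re) :
    fourierBinom b 0 = 2 * Real.pi := by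
  have h1 : ContinuousOn (fun u : ℂ => (1 + u) ^ b) (Metric.closedBall 0 1) := by
    intro u hu
    have hre : 0 ≤ (1 + u).re := by
      have h2 := (abs_le.1 (Complex.abs_re_le_norm u)).1
      have h3 := mem_closedBall_zero_iff.1 hu
      simp only [Complex.add_re, Complex.one_re]; linarith
    exact (ContinuousAt.comp (f := fun u : ℂ => 1 + u)
      (Complex.continuousAt_cpow_const_of_re_pos (Or.inl hre) hb) (by fun_prop)).continuousWithinAt
  have h2 (u : ℂ) (hu : u ∈ Metric.ball (0 : ℂ) 1 \ ∅) :
      DifferentiableAt ℂ (fun u : ℂ => (1 + u) ^ b) u := by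
    have hre : 0 < (1 + u).re := by
      have h2 := (abs_le.1 (Complex.abs_re_le_norm u)).1
      have h3 := mem_ball_zero_iff.1 hu.1
      simp only [Complex.add_re, Complex.one_re]; linarith
    exact DifferentiableAt.cpow_const (by fun_prop) (Or.inl hre)
  have h3 := Complex.circleIntegral_sub_inv_smul_of_differentiable_on_off_countable
    (w := 0) Set.countable_empty (Metric.mem_ball_self one_pos) h1 h2
  simp only [circleIntegral, deriv_circleMap, smul_eq_mul, sub_zero, add_zero, Complex.one_cpow,
    mul_one] at h3
  have h4 : fourierBinom b 0 = ∫ θ in (0 : ℝ)..2 * Real.pi,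
      (1 + Complex.exp (θ * Complex.I)) ^ b := by
    have hper : Function.Periodic (fun θ : ℝ => (1 + Complex.exp (θ * Complex.I)) ^ b)
        (2 * Real.pi) := by
      intro θ
      dsimp only
      rw [show ((θ + 2 * Real.pi : ℝ) : ℂ) * Complex.I = θ * Complex.I + 2 * Real.pi * Complex.I by
        push_cast; ring, Complex.exp_add, Complex.exp_two_pi_mul_I, mul_one]
    have := hper.intervalIntegral_add_eq (-Real.pi) 0
    rw [zero_add, show -Real.pi + 2 * Real.pi = Real.pi by ring] at this
    rw [fourierBinom, ← this]
    simp
  have h5 : (∫ θ in (0 : ℝ)..2 * Real.pi, circleMap 0 1 θ * Complex.I *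
      ((circleMap 0 1 θ)⁻¹ * (1 + circleMap 0 1 θ) ^ b)) =
      Complex.I * ∫ θ in (0 : ℝ)..2 * Real.pi, (1 + Complex.exp (θ * Complex.I)) ^ b := by
    rw [← intervalIntegral.integral_const_mul]
    refine intervalIntegral.integral_congr fun θ _ => ?_
    have : circleMap 0 1 θ ≠ 0 := circleMap_ne_center one_ne_zero
    have h6 : circleMap 0 1 θ = Complex.exp (θ * Complex.I) := by simp [circleMap]
    rw [mul_comm _ Complex.I, mul_assoc, mul_inv_cancel_left₀ this, h6]
  rw [h5, ← h4] at h3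
  exact mul_left_cancel₀ Complex.I_ne_zero (by rw [h3]; ring)

/-- The range is lowered from `Re b > 0` by the two recurrences: write `c(b, l)` for the
coefficients; then `(b+1) c(b,0) = c(b+1,1) = c(b+2,1) - c(b+1,0) = (b+2) 2π - 2π`. -/
theorem fourierBinom_zero {b : ℂ} (hb : -1 < b.re) : fourierBinom b 0 = 2 * Real.pi := by
  have hb1 : b + 1 ≠ 0 := by
    intro h; have := congrArg Complex.re h; simp at this; linarith
  have h1 := mul_fourierBinom (b := b + 1) (by simp; linarith) 1
  have h2 := mul_fourierBinom (b := b + 1 + 1) (by simp; linarith) 1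
  have h3 := fourierBinom_add_one (b := b + 1) (by simp; linarith) 1
  have h4 := fourierBinom_zero_of_re_pos (b := b + 1) (by simp; linarith)
  simp only [add_sub_cancel_right, sub_self, Int.cast_one, one_mul] at h1 h2 h3
  rw [h4] at h2 h3
  refine mul_left_cancel₀ hb1 ?_
  linear_combination -h1 + h2 - h3

/-- Eliminating `b + 1` between Pascal's rule and integration by parts leaves a recurrence in `l`
alone. Upwards from `l = 0` it produces the binomial coefficients, downwards it produces zeros. -/
theorem mul_fourierBinom_eq {b : ℂ} (hb : -1 < b.re) (l : ℤ) :
    l * fourierBinom b l = (b + 1 - l) * fourierBinom b (l - 1) := by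
  have h1 := mul_fourierBinom (b := b + 1) (by simp; linarith) l
  have h2 := fourierBinom_add_one hb l
  rw [add_sub_cancel_right] at h1
  linear_combination h1 - l * h2

theorem fourierBinom_natCast {b : ℂ} (hb : -1 < b.re) (l : ℕ) :
    fourierBinom b l = 2 * Real.pi * ((∏ i ∈ Finset.range l, (b - i)) / l.factorial) := by
  induction l with
  | zero => simpa using fourierBinom_zero hb
  | succ l ih =>
    have h1 := mul_fourierBinom_eq hb (l + 1 : ℕ)
    rw [show ((l + 1 : ℕ) : ℤ) - 1 = l by simp, ih] at h1
    have h2 : ((l : ℂ) + 1) ≠ 0 := Nat.cast_add_one_ne_zero l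
    have h3 : (l.factorial : ℂ) ≠ 0 := Nat.cast_ne_zero.2 l.factorial_ne_zero
    rw [Finset.prod_range_succ, Nat.factorial_succ]
    push_cast at h1 ⊢
    refine mul_left_cancel₀ h2 ?_
    rw [h1]
    field_simp
    ring

/-- At `l = 0` the recurrence reads `0 = (b+1) c(b,-1)`, and the zero propagates because `b + 1 - l`
has positive real part for every `l ≤ 0`. -/
theorem fourierBinom_neg {b : ℂ} (hb : -1 < b.re) (l : ℕ) : fourierBinom b (-(l + 1 : ℕ)) = 0 := by
  induction l with
  | zero =>
    have h1 := mul_fourierBinom_eq hb 0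
    have hb1 : b + 1 ≠ 0 := by
      intro h; have := congrArg Complex.re h; simp at this; linarith
    simpa [hb1] using h1
  | succ l ih =>
    have h1 := mul_fourierBinom_eq hb (-(l + 1 : ℕ))
    rw [ih, mul_zero, show -((l + 1 : ℕ) : ℤ) - 1 = -(l + 1 + 1 : ℕ) by push_cast; ring] at h1
    refine (mul_eq_zero.1 h1.symm).resolve_left fun h => ?_
    have := congrArg Complex.re h
    simp at this
    have h0 : (0 : ℝ) ≤ l := l.cast_nonneg
    linarith

/-- Cauchy's integral of a power of `cos (θ / 2)` times a cosine, in terms of the Fourier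
coefficients of a binomial. -/
theorem integral_exp_mul_cos {b : ℂ} (hb : -1 < b.re) (l : ℤ) :
    ∫ θ in (0 : ℝ)..Real.pi, Complex.exp (b / 2 * Real.log (1 + Real.cos θ)) *
      Complex.cos ((b / 2 - l) * θ) = Complex.exp (-(b / 2 * Real.log 2)) * fourierBinom b l / 2 := by
  set f : ℝ → ℂ := fun θ => (1 + Complex.exp (θ * Complex.I)) ^ b *
      Complex.exp (-(l * θ * Complex.I)) with hf
  have hint : IntervalIntegrable f volume (-Real.pi) Real.pi :=
    intervalIntegrable_one_add_exp_cpow hb l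
  have hpi := Real.pi_pos
  have hi1 : IntervalIntegrable f volume (-Real.pi) 0 :=
    hint.mono_set (by rw [Set.uIcc_of_le, Set.uIcc_of_le]; exact Set.Icc_subset_Icc_right hpi.le
                      all_goals linarith)
  have hi2 : IntervalIntegrable f volume 0 Real.pi :=
    hint.mono_set (by rw [Set.uIcc_of_le, Set.uIcc_of_le]; apply Set.Icc_subset_Icc_left
                      all_goals linarith)
  have hi3 : IntervalIntegrable (fun θ => f (-θ)) volume 0 Real.pi := by
    have := hi1.comp_mul_left (c := -1)
    simp only [neg_one_mul, div_neg, div_one, neg_zero, neg_neg] at this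
    exact this.symm
  -- Folding at `θ = 0` adds the phases `e^{±i(b/2 - l)θ}`, while the modulus factor is even in `θ`;
  -- this produces the cosine.
  have h1 : fourierBinom b l = ∫ θ in (0 : ℝ)..Real.pi, (f (-θ) + f θ) := by
    rw [intervalIntegral.integral_add hi3 hi2, intervalIntegral.integral_comp_neg, neg_zero,
      intervalIntegral.integral_add_adjacent_intervals hi1 hi2, fourierBinom]
  have h2 : ∫ θ in (0 : ℝ)..Real.pi, (f (-θ) + f θ) =
      ∫ θ in (0 : ℝ)..Real.pi, 2 * Complex.exp (b / 2 * Real.log 2) *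
        (Complex.exp (b / 2 * Real.log (1 + Real.cos θ)) * Complex.cos ((b / 2 - l) * θ)) := by
    refine intervalIntegral.integral_congr_ae ?_
    have h0 : ∀ᵐ θ : ℝ ∂volume, θ ≠ Real.pi := by simp [ae_iff]
    filter_upwards [h0] with θ hθ hmem
    rw [Set.uIoc_of_le hpi.le] at hmem
    have hm1 : θ ∈ Set.Ioo (-Real.pi) Real.pi :=
      ⟨by linarith [hmem.1], lt_of_le_of_ne hmem.2 hθ⟩
    have hm2 : -θ ∈ Set.Ioo (-Real.pi) Real.pi := ⟨by linarith [hm1.2], by linarith [hm1.1]⟩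
    simp only [hf]
    rw [one_add_exp_cpow hm1, one_add_exp_cpow hm2, Real.cos_neg]
    have e1 : Complex.exp (b / 2 * θ * Complex.I) * Complex.exp (-(l * θ * Complex.I)) =
        Complex.exp ((b / 2 - l) * θ * Complex.I) := by
      rw [← Complex.exp_add]; congr 1; ring
    have e2 : Complex.exp (b / 2 * (-θ : ℝ) * Complex.I) *
        Complex.exp (-(l * (-θ : ℝ) * Complex.I)) =
        Complex.exp (-((b / 2 - l) * θ) * Complex.I) := by
      rw [← Complex.exp_add]; congr 1; push_cast; ring
    rw [mul_assoc, e2, mul_assoc (Complex.exp _ * Complex.exp _), e1, Complex.cos]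
    ring
  rw [h1, h2, intervalIntegral.integral_const_mul, Complex.exp_neg]
  have := Complex.exp_ne_zero (b / 2 * Real.log 2)
  field_simp

/-! ### The incomplete gamma function as a series in `1/Γ` -/

open PowerSeries in
theorem tsum_mul_tsum_eq_tsum_coeff_mul {A D : PowerSeries ℂ} {x : ℂ}
    (hA : Summable fun n => ‖coeff n A * x ^ n‖) (hD : Summable fun n => ‖coeff n D * x ^ n‖) :
    (∑' n, coeff n A * x ^ n) * ∑' n, coeff n D * x ^ n = ∑' n, coeff n (A * D) * x ^ n := by
  rw [tsum_mul_tsum_eq_tsum_sum_antidiagonal_of_summable_norm hA hD]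
  refine tsum_congr fun n => ?_
  rw [coeff_mul, Finset.sum_mul]
  refine Finset.sum_congr rfl fun p hp => ?_
  rw [← Finset.HasAntidiagonal.mem_antidiagonal.1 hp, pow_add]
  ring

theorem tsum_coeff_exp (x : ℂ) :
    ∑' n, PowerSeries.coeff n (PowerSeries.exp ℂ) * x ^ n = Complex.exp x := by
  rw [Complex.exp_eq_exp_ℂ, NormedSpace.exp_eq_tsum_div]
  refine tsum_congr fun n => ?_
  rw [PowerSeries.coeff_exp]
  simp [div_eq_inv_mul]

theorem summable_norm_coeff_exp (x : ℂ) :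
    Summable fun n => ‖PowerSeries.coeff n (PowerSeries.exp ℂ) * x ^ n‖ := by
  refine (NormedSpace.norm_expSeries_div_summable x).congr fun n => ?_
  rw [PowerSeries.coeff_exp]
  simp [div_eq_inv_mul]

-- The series `h` satisfies `X h' + ν h = e^{-X}`, so `g = e^X h` satisfies `X g' + ν g = 1 + X g`.
-- Comparing coefficients, `(ν+n) g_n = g_{n-1}` with `ν g_0 = 1`, which is the recurrence of
-- `1/Γ(ν+n+1)` up to the factor `Γ(ν)`.
open PowerSeries in
theorem coeff_exp_mul_mk_inv (ν : ℂ) (hν : ∀ n : ℕ, ν ≠ -(n : ℂ)) (n : ℕ) :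
    (Complex.Gamma ν)⁻¹ * coeff n (PowerSeries.exp ℂ *
      PowerSeries.mk fun m => (-1) ^ m / ((ν + m) * (m.factorial : ℂ))) =
      (Complex.Gamma (ν + n + 1))⁻¹ := by
  have hne (m : ℕ) : ν + m ≠ 0 := fun h => hν m (eq_neg_of_add_eq_zero_left h)
  set h : PowerSeries ℂ := PowerSeries.mk fun m => (-1) ^ m / ((ν + m) * (m.factorial : ℂ)) with hh
  set E : PowerSeries ℂ := PowerSeries.exp ℂ with hE
  have h1 : X * d⁄dX ℂ h + C ν * h = evalNegHom E := by
    ext n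
    have hL : coeff n (X * d⁄dX ℂ h) = n * coeff n h := by
      cases n with
      | zero => simp
      | succ n => rw [coeff_succ_X_mul, coeff_derivative]; push_cast; ring
    rw [map_add, hL, coeff_C_mul, hh, coeff_mk, evalNegHom, coeff_rescale, hE, coeff_exp]
    have := hne n
    have h3 : (n.factorial : ℂ) ≠ 0 := Nat.cast_ne_zero.2 n.factorial_ne_zero
    simp
    field_simp
    ring
  have h2 : X * d⁄dX ℂ (E * h) + C ν * (E * h) = 1 + X * (E * h) := by
    have h3 : d⁄dX ℂ E = E := derivative_exp ℂ
    have h4 : E * evalNegHom E = 1 := exp_mul_exp_neg_eq_one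
    rw [Derivation.leibniz, h3, smul_eq_mul, smul_eq_mul, ← h4, ← h1]
    ring
  have hrec (n : ℕ) : (ν + n) * coeff n (E * h) = if n = 0 then 1 else coeff (n - 1) (E * h) := by
    have h5 := congrArg (coeff n) h2
    cases n with
    | zero => simpa using h5
    | succ n =>
      rw [map_add, map_add, coeff_succ_X_mul, coeff_succ_X_mul, coeff_derivative, coeff_C_mul,
        coeff_one] at h5
      simp only [Nat.add_eq_zero_iff, one_ne_zero, and_false, if_false, zero_add,
        Nat.add_sub_cancel] at h5 ⊢
      push_cast
      linear_combination h5
  induction n with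
  | zero =>
    have h5 := hrec 0
    have h6 := Complex.one_div_Gamma_eq_self_mul_one_div_Gamma_add_one ν
    simp only [Nat.cast_zero, add_zero, if_true] at h5 ⊢
    rw [h6]
    linear_combination (Complex.Gamma (ν + 1))⁻¹ * h5
  | succ n ih =>
    have h5 := hrec (n + 1)
    simp only [Nat.add_eq_zero_iff, one_ne_zero, and_false, if_false, Nat.add_sub_cancel] at h5
    refine mul_left_cancel₀ (hne (n + 1)) ?_
    have h6 := Complex.one_div_Gamma_eq_self_mul_one_div_Gamma_add_one (ν + (n + 1 : ℕ))
    rw [← h6, mul_left_comm, h5, ih]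
    push_cast
    rw [add_assoc]

/-- The Cauchy product with `exp w` absorbs the denominators `ν + k` into reciprocal gamma
functions, leaving a series that is entire in both variables. -/
theorem gammaStar_eq_of_ne {ν : ℂ} (hν : ∀ n : ℕ, ν ≠ -(n : ℂ)) (w : ℂ) :
    gammaStar ν w = Complex.exp (-w) * rgSeries ν w := by
  have hne (m : ℕ) : ν + m ≠ 0 := fun h => hν m (eq_neg_of_add_eq_zero_left h)
  set h : PowerSeries ℂ := PowerSeries.mk fun m => (-1) ^ m / ((ν + m) * (m.factorial : ℂ)) with hh
  have hterm (m : ℕ) : PowerSeries.coeff m h * w ^ m = (-w) ^ m / ((ν + m) * (m.factorial : ℂ)) := by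
    rw [hh, PowerSeries.coeff_mk, neg_pow w]; ring
  have hD : Summable fun m => ‖PowerSeries.coeff m h * w ^ m‖ := by
    have hlim : Tendsto (fun m : ℕ => ‖ν + m‖) atTop atTop := by
      refine tendsto_atTop_mono (fun m => ?_) (tendsto_atTop_add_const_right atTop (-‖ν‖)
        (tendsto_natCast_atTop_atTop (R := ℝ)))
      have := norm_sub_le (ν + m) ν
      rw [add_sub_cancel_left, Complex.norm_natCast] at this
      linarith
    refine Summable.of_norm_bounded_eventually_nat (Real.summable_pow_div_factorial ‖w‖) ?_
    filter_upwards [hlim.eventually_ge_atTop 1] with m hm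
    rw [hterm, norm_norm, norm_div, norm_mul, norm_pow, norm_neg, Complex.norm_natCast]
    gcongr
    have : (0 : ℝ) < m.factorial := by exact_mod_cast m.factorial_pos
    nlinarith
  have hmul := tsum_mul_tsum_eq_tsum_coeff_mul (summable_norm_coeff_exp w) hD
  rw [tsum_coeff_exp] at hmul
  have h0 : ¬ ∃ n : ℕ, ν = -(n : ℂ) := fun ⟨n, hn⟩ => hν n hn
  have h1 : rgSeries ν w = (Complex.Gamma ν)⁻¹ * (Complex.exp w * ∑' m, PowerSeries.coeff m h * w ^ m) := by
    rw [hmul, ← tsum_mul_left]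
    refine tsum_congr fun n => ?_
    rw [← mul_assoc, coeff_exp_mul_mk_inv ν hν, mul_comm]
  rw [gammaStar, if_neg h0, h1, Complex.exp_neg, tsum_congr hterm]
  have := Complex.exp_ne_zero w
  field_simp

theorem gammaStar_zero (w : ℂ) : gammaStar 0 w = 1 := by
  rw [gammaStar, if_pos ⟨0, by simp⟩, neg_zero, Complex.cpow_zero]

theorem rgSeries_zero (w : ℂ) : rgSeries 0 w = Complex.exp w := by
  rw [rgSeries, Complex.exp_eq_exp_ℂ, NormedSpace.exp_eq_tsum_div]
  refine tsum_congr fun n => ?_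
  rw [zero_add, Complex.Gamma_nat_eq_factorial, div_eq_mul_inv]

/-- The normalised lower incomplete gamma function through the series `∑ w^k / Γ(ν+k+1)`. -/
theorem normGammaP_eq {ν : ℂ} (hν : -1 < ν.re) (s : ℂ) :
    normGammaP ν s =
      Complex.exp (ν * s) * (Complex.exp (-Complex.exp s) * rgSeries ν (Complex.exp s)) := by
  rw [normGammaP]
  congr 1
  by_cases h0 : ν = 0
  · rw [h0, gammaStar_zero, rgSeries_zero, ← Complex.exp_add, neg_add_cancel, Complex.exp_zero]
  -- In the half-plane `Re ν > -1` the only exceptional parameter is `ν = 0`, which was treated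
  -- separately.
  · refine gammaStar_eq_of_ne (fun n hn => ?_) _
    rcases Nat.eq_zero_or_pos n with h | h
    · exact h0 (by rw [hn, h]; simp)
    · have h1 : (1 : ℝ) ≤ n := by exact_mod_cast h
      rw [hn] at hν
      simp at hν
      linarith

/-! ### Kummer's form of the Bessel series -/

open PowerSeries in
/-- The even power series `∑ x^(2k) / (k! Γ(μ+k+1))`. -/
def besselPS (μ : ℂ) : PowerSeries ℂ := PowerSeries.mk fun n =>
  if Even n then ((n / 2).factorial : ℂ)⁻¹ * (Complex.Gamma (μ + (n / 2 : ℕ) + 1))⁻¹ else 0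

open PowerSeries in
theorem coeff_besselPS_add_two (μ : ℂ) (n : ℕ) :
    (n + 2) * (n + 2 + 2 * μ) * coeff (n + 2) (besselPS μ) = 4 * coeff n (besselPS μ) := by
  rw [besselPS, coeff_mk, coeff_mk]
  by_cases h : Even n
  · obtain ⟨k, rfl⟩ := h
    have h1 : (k + k + 2) / 2 = k + 1 := by omega
    have h2 : (k + k) / 2 = k := by omega
    rw [if_pos (by exact ⟨k + 1, by ring⟩), if_pos ⟨k, rfl⟩, h1, h2,
      Complex.one_div_Gamma_eq_self_mul_one_div_Gamma_add_one (μ + k + 1), Nat.factorial_succ]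
    have h3 : (k.factorial : ℂ) ≠ 0 := Nat.cast_ne_zero.2 k.factorial_ne_zero
    have h4 : (k : ℂ) + 1 ≠ 0 := Nat.cast_add_one_ne_zero k
    push_cast
    rw [← add_assoc μ]
    field_simp
    ring
  · rw [if_neg (by rwa [Nat.even_add, iff_true_right even_two]), if_neg h]
    simp

-- The Bessel series satisfies `X F'' + (2μ+1) F' = 4 X F`. Multiplication by `E = e^{2X}` turns
-- this into `X G'' + (2μ+1) G' = 4 X G' + 2(2μ+1) G` for `G = E F`, an equation whose coefficient
-- recurrence has only two terms.
open PowerSeries in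
theorem coeff_exp_mul_besselPS_succ (μ : ℂ) (l : ℕ) :
    (l + 1) * (l + 2 * μ + 1) * coeff (l + 1) (rescale 2 (PowerSeries.exp ℂ) * besselPS μ) =
      2 * (2 * l + 2 * μ + 1) * coeff l (rescale 2 (PowerSeries.exp ℂ) * besselPS μ) := by
  set F := besselPS μ with hF
  set E : PowerSeries ℂ := rescale 2 (PowerSeries.exp ℂ) with hE
  have hodd : coeff 1 F = 0 := by rw [hF, besselPS, coeff_mk, if_neg (by decide)]
  have h1 : X * d⁄dX ℂ (d⁄dX ℂ F) + C (2 * μ + 1) * d⁄dX ℂ F = C 4 * (X * F) := by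
    ext n
    rw [map_add, coeff_C_mul, coeff_C_mul]
    cases n with
    | zero => rw [coeff_derivative]; simp [hodd]
    | succ n =>
      rw [coeff_succ_X_mul, coeff_succ_X_mul, coeff_derivative, coeff_derivative]
      have := coeff_besselPS_add_two μ n
      push_cast
      linear_combination this
  have h2 : d⁄dX ℂ E = C 2 * E := by
    ext n
    rw [coeff_derivative, coeff_C_mul, hE, coeff_rescale, coeff_rescale, coeff_exp, coeff_exp,
      Nat.factorial_succ]
    have h3 : (n.factorial : ℂ) ≠ 0 := Nat.cast_ne_zero.2 n.factorial_ne_zero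
    have h4 : (n : ℂ) + 1 ≠ 0 := Nat.cast_add_one_ne_zero n
    push_cast
    simp
    field_simp
    ring
  have hC2 : d⁄dX ℂ (C (2 : ℂ)) = 0 := by simp
  have h3 : X * d⁄dX ℂ (d⁄dX ℂ (E * F)) + C (2 * μ + 1) * d⁄dX ℂ (E * F) =
      C 4 * (X * d⁄dX ℂ (E * F)) + C (2 * (2 * μ + 1)) * (E * F) := by
    have e1 : (C (4 : ℂ) : PowerSeries ℂ) = 4 := map_ofNat C 4
    have e2 : (C (2 : ℂ) : PowerSeries ℂ) = 2 := map_ofNat C 2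
    simp only [Derivation.leibniz, map_add, smul_eq_mul, h2, hC2, map_mul C] at h1 ⊢
    rw [e1, e2] at h1
    rw [e1, e2]
    linear_combination E * h1
  have h4 := congrArg (coeff l) h3
  rw [LinearMap.map_add, LinearMap.map_add, coeff_C_mul, coeff_C_mul, coeff_C_mul] at h4
  cases l with
  | zero =>
    rw [coeff_derivative] at h4
    simp only [coeff_zero_X_mul, Nat.cast_zero, zero_add] at h4 ⊢
    linear_combination h4
  | succ l =>
    rw [coeff_succ_X_mul, coeff_succ_X_mul, coeff_derivative, coeff_derivative,
      coeff_derivative] at h4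
    push_cast at h4 ⊢
    linear_combination h4

/-- The coefficients of Kummer's form of the Bessel series. -/
def kummerCoeff (μ : ℂ) (l : ℕ) : ℂ :=
  (∏ i ∈ Finset.range l, (2 * (μ + l) - i)) / l.factorial * (Complex.Gamma (μ + l + 1))⁻¹

theorem kummerCoeff_succ (μ : ℂ) (l : ℕ) :
    (l + 1) * (l + 2 * μ + 1) * kummerCoeff μ (l + 1) =
      2 * (2 * l + 2 * μ + 1) * kummerCoeff μ l := by
  have h1 : (∏ i ∈ Finset.range (l + 1), (2 * (μ + (l + 1 : ℕ)) - i)) * (l + 2 * μ + 1) =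
      (∏ i ∈ Finset.range l, (2 * (μ + l) - i)) * (2 * μ + 2 * l + 1) * (2 * μ + 2 * l + 2) := by
    have h2 := Finset.prod_range_succ (fun i : ℕ => 2 * (μ + (l + 1 : ℕ)) - i) (l + 1)
    rw [Finset.prod_range_succ', Finset.prod_range_succ'] at h2
    have h3 : ∏ i ∈ Finset.range l, (2 * (μ + (l + 1 : ℕ)) - (i + 1 + 1 : ℕ)) =
        ∏ i ∈ Finset.range l, (2 * (μ + l) - i) :=
      Finset.prod_congr rfl fun i _ => by push_cast; ring
    rw [h3] at h2
    push_cast at h2 ⊢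
    linear_combination -h2
  have h3 : (l.factorial : ℂ) ≠ 0 := Nat.cast_ne_zero.2 l.factorial_ne_zero
  have h4 : (l : ℂ) + 1 ≠ 0 := Nat.cast_add_one_ne_zero l
  rw [kummerCoeff, kummerCoeff,
    Complex.one_div_Gamma_eq_self_mul_one_div_Gamma_add_one (μ + l + 1), Nat.factorial_succ,
    show μ + ((l + 1 : ℕ) : ℂ) + 1 = μ + l + 1 + 1 by push_cast; ring]
  rw [Nat.cast_mul, Nat.cast_succ] at *
  field_simp
  linear_combination (Complex.Gamma (μ + l + 1 + 1))⁻¹ * h1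

-- Both sides obey the same two-term recurrence, but its leading factor vanishes for `μ = -(l+1)/2`.
-- The induction is therefore run off this countable set, and the rest follows by continuity in `μ`
-- and density.
open PowerSeries in
theorem coeff_exp_mul_besselPS (μ : ℂ) (l : ℕ) :
    coeff l (rescale 2 (PowerSeries.exp ℂ) * besselPS μ) = kummerCoeff μ l := by
  have hG : Continuous fun μ : ℂ => (Complex.Gamma μ)⁻¹ :=
    Complex.differentiable_one_div_Gamma.continuous
  have hcF (n : ℕ) : Continuous fun μ => coeff n (besselPS μ) := by
    simp only [besselPS, coeff_mk]
    split_ifs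
    · exact continuous_const.mul (hG.comp (by fun_prop))
    · exact continuous_const
  have hc1 : Continuous fun μ => coeff l (rescale 2 (PowerSeries.exp ℂ) * besselPS μ) := by
    simp only [coeff_mul]
    exact continuous_finsetSum _ fun p _ => continuous_const.mul (hcF _)
  have hc2 : Continuous fun μ => kummerCoeff μ l := by
    simp only [kummerCoeff]
    refine Continuous.mul ?_ (hG.comp (by fun_prop))
    fun_prop
  have hd : Dense (Set.range fun n : ℕ => (-(n + 1) / 2 : ℂ))ᶜ :=
    (Set.countable_range _).dense_compl ℝ
  refine congrFun (hc1.ext_on hd hc2 fun ν hν => ?_) μ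
  dsimp only
  clear hcF hc1 hc2
  induction l with
  | zero => simp [kummerCoeff, besselPS, coeff_mul]
  | succ l ih =>
    have h1 : (l : ℂ) + 2 * ν + 1 ≠ 0 := by
      intro h
      refine hν ⟨l, ?_⟩
      dsimp only
      linear_combination -h / 2
    refine mul_left_cancel₀ (mul_ne_zero (Nat.cast_add_one_ne_zero l) h1) ?_
    rw [coeff_exp_mul_besselPS_succ, kummerCoeff_succ, ih]

/-- Kummer's transformation: with `x = -iz/2` the Bessel series is the even series `F(x)`, and
`e^{2x} F(x)` has the coefficients just found, while `e^{-2x} = e^{iz}`. -/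
theorem besselJ_eq (μ z : ℂ) : besselJ μ z = (z / 2) ^ μ * Complex.exp (Complex.I * z) *
    ∑' l : ℕ, kummerCoeff μ l * (-Complex.I * z / 2) ^ l := by
  set x := -Complex.I * z / 2 with hx
  have hx2 : x ^ 2 = -(z / 2) ^ 2 := by
    rw [hx]; linear_combination (z ^ 2 / 4) * Complex.I_sq
  have hinj : Function.Injective fun k : ℕ => 2 * k := fun a b h => by simpa using h
  have hzero (n : ℕ) (hn : n ∉ Set.range fun k : ℕ => 2 * k) :
      PowerSeries.coeff n (besselPS μ) * x ^ n = 0 := by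
    rw [besselPS, PowerSeries.coeff_mk, if_neg, zero_mul]
    rintro ⟨k, rfl⟩
    exact hn ⟨k, by dsimp only; ring⟩
  have hval (k : ℕ) : PowerSeries.coeff (2 * k) (besselPS μ) * x ^ (2 * k) =
      (-1) ^ k * (z / 2) ^ (2 * k) * ((k.factorial : ℂ) * Complex.Gamma (μ + k + 1))⁻¹ := by
    rw [besselPS, PowerSeries.coeff_mk, if_pos (even_two_mul k), Nat.mul_div_cancel_left k two_pos,
      pow_mul, hx2, neg_pow, pow_mul, mul_inv]
    ring
  have hsF : Summable fun n => ‖PowerSeries.coeff n (besselPS μ) * x ^ n‖ := by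
    rw [← hinj.summable_iff fun n hn => by rw [hzero n hn, norm_zero]]
    refine Summable.of_nonneg_of_le (fun _ => norm_nonneg _) (fun k => ?_)
      (summable_norm_rgSeries μ ((z / 2) ^ 2))
    dsimp only [Function.comp_apply]
    rw [hval, norm_mul, norm_mul, norm_pow, norm_neg, norm_one, one_pow, one_mul, mul_inv,
      norm_mul, norm_inv, Complex.norm_natCast, norm_mul, ← pow_mul]
    gcongr
    refine mul_le_of_le_one_left (norm_nonneg _) (inv_le_one_of_one_le₀ ?_)
    exact_mod_cast k.factorial_pos
  have hE (n : ℕ) : PowerSeries.coeff n (PowerSeries.rescale (2 : ℂ) (PowerSeries.exp ℂ)) * x ^ n =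
      PowerSeries.coeff n (PowerSeries.exp ℂ) * (2 * x) ^ n := by
    rw [PowerSeries.coeff_rescale, mul_pow]; ring
  have hsE : Summable fun n =>
      ‖PowerSeries.coeff n (PowerSeries.rescale (2 : ℂ) (PowerSeries.exp ℂ)) * x ^ n‖ := by
    simp only [hE]; exact summable_norm_coeff_exp _
  have hmul := tsum_mul_tsum_eq_tsum_coeff_mul hsE hsF
  rw [tsum_congr hE, tsum_coeff_exp] at hmul
  have h1 : ∑' n, PowerSeries.coeff n (besselPS μ) * x ^ n = ∑' k : ℕ,
      (-1) ^ k * (z / 2) ^ (2 * k) * ((k.factorial : ℂ) * Complex.Gamma (μ + k + 1))⁻¹ := by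
    rw [← hinj.tsum_eq (Function.support_subset_iff'.2 hzero)]
    exact tsum_congr hval
  rw [besselJ, ← h1, mul_assoc]
  congr 1
  simp only [coeff_exp_mul_besselPS] at hmul
  rw [← hmul, ← mul_assoc, ← Complex.exp_add, show Complex.I * z + 2 * x = 0 by rw [hx]; ring,
    Complex.exp_zero, one_mul]

/-! ### The correction as the missing Kummer terms -/

theorem Gamma_half_sub_natCast (r : ℕ) :
    Complex.Gamma (1 / 2 - r) * (2 * r).factorial * (-1) ^ r =
      (Real.sqrt Real.pi : ℝ) * (r.factorial * 4 ^ r) := by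
  induction r with
  | zero =>
    simp only [Nat.cast_zero, sub_zero, Complex.Gamma_one_half_eq]
    rw [Real.sqrt_eq_rpow, Complex.ofReal_cpow Real.pi_pos.le]
    simp
  | succ r ih =>
    have hne : (1 / 2 - ((r + 1 : ℕ) : ℂ)) ≠ 0 := by
      intro h
      have := congrArg Complex.re h
      simp at this
      have h0 : (0 : ℝ) ≤ r := r.cast_nonneg
      linarith
    have h1 := Complex.Gamma_add_one _ hne
    rw [show (1 / 2 - ((r + 1 : ℕ) : ℂ)) + 1 = 1 / 2 - r by push_cast; ring] at h1
    rw [h1] at ih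
    rw [show 2 * (r + 1) = 2 * r + 1 + 1 by ring, Nat.factorial_succ, Nat.factorial_succ,
      Nat.factorial_succ, pow_succ, pow_succ]
    push_cast at ih ⊢
    linear_combination 4 * (r + 1) * ih

theorem inv_Gamma_sub_natCast (x : ℂ) (l : ℕ) :
    (Complex.Gamma (x - l + 1))⁻¹ =
      (∏ i ∈ Finset.range l, (x - i)) * (Complex.Gamma (x + 1))⁻¹ := by
  induction l with
  | zero => simp
  | succ l ih =>
    rw [Complex.one_div_Gamma_eq_self_mul_one_div_Gamma_add_one, Finset.prod_range_succ,
      show x - ((l + 1 : ℕ) : ℂ) + 1 = x - l by push_cast; ring, ih]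
    ring

theorem prod_neg_sub_natCast (q l : ℕ) :
    (∏ i ∈ Finset.range l, (-((q : ℂ) + 1) - i)) * q.factorial = (-1) ^ l * (q + l).factorial := by
  induction l with
  | zero => simp
  | succ l ih =>
    rw [Finset.prod_range_succ, pow_succ, ← add_assoc, Nat.factorial_succ]
    push_cast
    linear_combination (-((q : ℂ) + 1) - l) * ih

theorem nearestInt_lt {x : ℝ} : (nearestInt x : ℝ) < x + 1 / 2 := by
  have := Int.ceil_lt_add_one (x - 1 / 2)
  rw [nearestInt]; linarith

theorem sub_half_le_nearestInt {x : ℝ} : x - 1 / 2 ≤ nearestInt x := Int.le_ceil _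

theorem nearestInt_eq {x : ℝ} {n : ℤ} (h1 : (n : ℝ) < x + 1 / 2) (h2 : x - 1 / 2 ≤ n) :
    nearestInt x = n := by
  rw [nearestInt, Int.ceil_eq_iff]
  exact ⟨by linarith, h2⟩

/-- The terms of the correction are the missing terms of Kummer's series. -/
theorem kummerCoeff_eq_gammaQuotient {μ : ℂ} {l : ℕ} (hl : μ.re + l ≤ -1 / 2) :
    kummerCoeff μ l = Complex.exp (2 * (μ + l) * Real.log 2) / (Real.sqrt Real.pi : ℝ) *
      (gammaQuotient μ (l + 1) / Complex.Gamma (l + 1 : ℕ)) := by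
  have hpi : ((Real.sqrt Real.pi : ℝ) : ℂ) ≠ 0 :=
    Complex.ofReal_ne_zero.2 (Real.sqrt_pos.2 Real.pi_pos).ne'
  have hlf : (l.factorial : ℂ) ≠ 0 := Nat.cast_ne_zero.2 l.factorial_ne_zero
  have hG : Complex.Gamma (l + 1 : ℕ) = l.factorial := by
    rw [Nat.cast_succ, Complex.Gamma_nat_eq_factorial]
  rw [hG, kummerCoeff]
  -- In terms of `a = μ + l` the claim is the duplication formula for `Γ(a + 1/2) Γ(a + 1)`, divided
  -- by `Γ(2a - l + 1)`. It must be treated separately where `Γ(2a + 1)` has a pole.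
  obtain ⟨a, rfl⟩ : ∃ a : ℂ, μ = a - l := ⟨μ + l, by ring⟩
  rw [sub_add_cancel]
  have hare : a.re ≤ -1 / 2 := by simpa using hl
  have hexp : Complex.exp (2 * a * Real.log 2) = 2 ^ (2 * a) := by
    rw [Complex.cpow_def_of_ne_zero two_ne_zero, ← Complex.ofReal_ofNat, ← Complex.ofReal_log
      (by norm_num)]
    congr 1; push_cast; ring
  by_cases hpole : ∃ q : ℕ, 2 * a + 1 = -(q : ℂ)
  · obtain ⟨q, hq⟩ := hpole
    rcases Nat.even_or_odd' q with ⟨r, rfl | rfl⟩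
    -- Here `μ` is a negative half-integer and the limiting value of the gamma quotient applies;
    -- since `m + 1/2` rounds to `m`, the nearest integer is `-r - 1 - l`.
    · have ha : a = -(r : ℂ) - 1 / 2 := by push_cast at hq; linear_combination hq / 2
      have hm : nearestInt (a - l).re = -(r : ℤ) - 1 - l := by
        apply nearestInt_eq <;> rw [ha] <;> simp <;> linarith
      have hex : ∃ m : ℤ, m ≤ -1 ∧ a - l = m + 1 / 2 :=
        ⟨-(r : ℤ) - 1 - l, by omega, by rw [ha]; push_cast; ring⟩
      have e1 : -((l + 1 : ℕ) : ℂ) - 2 * ((-(r : ℤ) - 1 - l : ℤ) : ℂ) = ((2 * r + l : ℕ) : ℂ) + 1 := by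
        push_cast; ring
      have e2 : -((l + 1 : ℕ) : ℂ) - ((-(r : ℤ) - 1 - l : ℤ) : ℂ) + 1 = (r : ℂ) + 1 := by
        push_cast; ring
      have e3 : ((-1 : ℂ)) ^ (-(r : ℤ) - 1 - l + 1) = (-1) ^ r * (-1) ^ l := by
        rw [show -(r : ℤ) - 1 - l + 1 = -((r + l : ℕ) : ℤ) by push_cast; ring, zpow_neg,
          zpow_natCast, pow_add, mul_inv, ← inv_pow, ← inv_pow]
        norm_num
      rw [gammaQuotient, if_pos hex, hm, e1, e2, e3, Complex.Gamma_nat_eq_factorial,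
        Complex.Gamma_nat_eq_factorial]
      have hp := prod_neg_sub_natCast (2 * r) l
      have hprod : ∏ i ∈ Finset.range l, (2 * a - (i : ℂ)) =
          ∏ i ∈ Finset.range l, (-(((2 * r : ℕ) : ℂ) + 1) - i) :=
        Finset.prod_congr rfl fun i _ => by rw [ha]; push_cast; ring
      have hgam := Gamma_half_sub_natCast r
      have h2r : ((2 * r).factorial : ℂ) ≠ 0 := Nat.cast_ne_zero.2 (Nat.factorial_ne_zero _)
      have hr : (r.factorial : ℂ) ≠ 0 := Nat.cast_ne_zero.2 r.factorial_ne_zero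
      have h4 : (4 : ℂ) ^ r ≠ 0 := pow_ne_zero _ (by norm_num)
      have hGne : Complex.Gamma (1 / 2 - r) ≠ 0 := by
        intro h0
        rw [h0, zero_mul, zero_mul] at hgam
        exact mul_ne_zero hpi (mul_ne_zero hr h4) hgam.symm
      have hx : Complex.exp (2 * a * Real.log 2) = (2 * 4 ^ r)⁻¹ := by
        rw [hexp, show 2 * a = ((-(2 * r + 1 : ℕ) : ℤ) : ℂ) by rw [ha]; push_cast; ring,
          Complex.cpow_intCast, zpow_neg, zpow_natCast, pow_succ, pow_mul]
        norm_num; ring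
      rw [hx, hprod, show a + 1 = 1 / 2 - (r : ℂ) by rw [ha]; ring, eq_div_of_mul_eq h2r hp]
      generalize Complex.Gamma (1 / 2 - r) = g at hgam hGne
      field_simp
      linear_combination -((2 * r + l).factorial : ℂ) * hgam
    · have ha : a = -((r : ℂ) + 1) := by push_cast at hq; linear_combination hq / 2
      have hex : ¬ ∃ m : ℤ, m ≤ -1 ∧ a - l = m + 1 / 2 := by
        rintro ⟨m, -, hm⟩
        rw [ha] at hm
        have h1 : ((-2 * (r + 1) - 2 * l : ℤ) : ℂ) = ((2 * m + 1 : ℤ) : ℂ) := by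
          push_cast; linear_combination 2 * hm
        have h2 := Int.cast_injective h1
        omega
      have h1 : Complex.Gamma (a + 1) = 0 := by
        rw [show a + 1 = -(r : ℂ) by rw [ha]; ring, Complex.Gamma_neg_nat_eq_zero]
      have h2 : Complex.Gamma ((l + 1 : ℕ) + 2 * (a - l)) = 0 := by
        rw [show ((l + 1 : ℕ) : ℂ) + 2 * (a - l) = -((2 * r + 1 + l : ℕ) : ℂ) by
          rw [ha]; push_cast; ring, Complex.Gamma_neg_nat_eq_zero]
      -- Both sides vanish: `1/Γ(a+1)` and `1/Γ(2a-l+1)` are taken at poles, where Lean's `Γ = 0`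
      -- and division by zero give the correct value `0`.
      rw [gammaQuotient, if_neg hex, h1, h2]
      simp
  · have hne : Complex.Gamma (2 * a + 1) ≠ 0 := by
      rw [Ne, Complex.Gamma_eq_zero_iff]; exact hpole
    have hne' : Complex.Gamma (a + 1) ≠ 0 := by
      rw [Ne, Complex.Gamma_eq_zero_iff]
      rintro ⟨m, hm⟩
      exact hpole ⟨2 * m + 1, by push_cast; linear_combination 2 * hm⟩
    have hex : ¬ ∃ m : ℤ, m ≤ -1 ∧ a - l = m + 1 / 2 := by
      rintro ⟨m, -, hm⟩
      have h1 : a = ((m + l : ℤ) : ℂ) + 1 / 2 := by push_cast; linear_combination hm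
      have h2 : (m + l : ℤ) + 1 / 2 ≤ (-1 / 2 : ℝ) := by
        rw [h1] at hare; simpa using hare
      have h3 : ((m + l + 1 : ℤ) : ℝ) ≤ 0 := by push_cast at h2 ⊢; linarith
      have h4 : m + l + 1 ≤ 0 := by exact_mod_cast h3
      refine hpole ⟨(-(2 * (m + l + 1))).toNat, ?_⟩
      have h5 : (((-(2 * (m + l + 1))).toNat : ℤ) : ℂ) = ((-(2 * (m + l + 1)) : ℤ) : ℂ) := by
        rw [Int.toNat_of_nonneg (by omega)]
      rw [Int.cast_natCast] at h5
      rw [h5, h1]; push_cast; ring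
    have h1 := inv_Gamma_sub_natCast (2 * a) l
    have hdup := Complex.Gamma_mul_Gamma_add_half (a + 1 / 2)
    rw [show a + 1 / 2 + 1 / 2 = a + 1 by ring, show 2 * (a + 1 / 2) = 2 * a + 1 by ring,
      show 1 - (2 * a + 1) = -(2 * a) by ring, Complex.cpow_neg] at hdup
    have h2 : (2 : ℂ) ^ (2 * a) ≠ 0 := by
      rw [← hexp]; exact Complex.exp_ne_zero _
    rw [gammaQuotient, if_neg hex, hexp,
      show ((l + 1 : ℕ) : ℂ) + (a - l) - 1 / 2 = a + 1 / 2 by push_cast; ring,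
      show ((l + 1 : ℕ) : ℂ) + 2 * (a - l) = 2 * a - l + 1 by push_cast; ring,
      div_eq_mul_inv (Complex.Gamma (a + 1 / 2)), h1]
    generalize Complex.Gamma (a + 1 / 2) = g₁ at hdup
    generalize Complex.Gamma (a + 1) = g₂ at hdup hne'
    generalize Complex.Gamma (2 * a + 1) = g₃ at hdup hne
    generalize (2 : ℂ) ^ (2 * a) = t at hdup h2
    generalize ∏ i ∈ Finset.range l, (2 * a - (i : ℂ)) = p
    field_simp at hdup ⊢
    linear_combination -p * hdup

/-! ### Termwise integration and `J = B + χ` -/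

theorem fracPart_re (μ : ℂ) : (fracPart μ).re = μ.re - nearestInt μ.re := by simp [fracPart]

theorem neg_half_lt_fracPart_re (μ : ℂ) : -1 / 2 < (fracPart μ).re := by
  rw [fracPart_re]; linarith [nearestInt_lt (x := μ.re)]

theorem exp_logNegI {z : ℂ} (hz : z ≠ 0) : Complex.exp (logNegI z) = -Complex.I * z := by
  rw [logNegI, Complex.exp_sub, Complex.exp_log hz, mul_comm Complex.I, Complex.exp_pi_div_two_mul_I,
    div_eq_mul_inv, Complex.inv_I]
  ring

theorem exp_logArg {z : ℂ} (hz : z ≠ 0) {θ : ℝ} (hθ : θ ∈ Set.Ioo (-Real.pi) Real.pi) :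
    Complex.exp (logArg z θ) = -Complex.I * z * (1 + Real.cos θ) := by
  rw [logArg, Complex.exp_add, exp_logNegI hz, ← Complex.ofReal_exp,
    Real.exp_log (one_add_cos_pos hθ)]
  push_cast; ring

/-- The factor `e^{-w}` in `P` combines with `e^{-iz cos θ}` to the constant `e^{iz}`, as `w = -iz(1
+ cos θ)`; only powers of `1 + cos θ` remain. -/
theorem exp_mul_normGammaP {z : ℂ} (hz : z ≠ 0) {θ : ℝ} (hθ : θ ∈ Set.Ioo (-Real.pi) Real.pi)
    {ν : ℂ} (hν : -1 < ν.re) :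
    Complex.exp (-Complex.I * z * Real.cos θ) * normGammaP ν (logArg z θ) =
      Complex.exp (Complex.I * z) * Complex.exp (ν * logArg z θ) *
        rgSeries ν (-Complex.I * z * (1 + Real.cos θ)) := by
  rw [normGammaP_eq hν, exp_logArg hz hθ]
  have : Complex.exp (Complex.I * z) = Complex.exp (-Complex.I * z * Real.cos θ) *
      Complex.exp (-(-Complex.I * z * (1 + Real.cos θ))) := by
    rw [← Complex.exp_add]; congr 1; ring
  rw [this]; ring

theorem measurable_logArg (z : ℂ) : Measurable (logArg z) := by
  unfold logArg; fun_prop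

theorem continuous_normGammaP {ν : ℂ} (hν : -1 < ν.re) : Continuous (normGammaP ν) := by
  have h : normGammaP ν = fun s =>
      Complex.exp (ν * s) * (Complex.exp (-Complex.exp s) * rgSeries ν (Complex.exp s)) :=
    funext fun s => normGammaP_eq hν s
  have h2 : Continuous fun s => rgSeries ν (Complex.exp s) :=
    (differentiable_rgSeries_right ν).continuous.comp Complex.continuous_exp
  rw [h]
  fun_prop

theorem measurable_exp_mul_normGammaP (z : ℂ) {ν : ℂ} (hν : -1 < ν.re) :
    Measurable fun θ : ℝ => Complex.exp (-Complex.I * z * Real.cos θ) *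
      normGammaP ν (logArg z θ) := by
  have := (continuous_normGammaP hν).measurable.comp (measurable_logArg z)
  simp only [Function.comp_def] at this
  fun_prop

theorem norm_exp_mul_logArg_le {z ν : ℂ} {R : ℝ} (hν : ‖ν‖ ≤ R) (θ : ℝ) :
    ‖Complex.exp (ν * logArg z θ)‖ ≤ Real.exp (R * ‖logNegI z‖) *
      Real.exp (ν.re * Real.log (1 + Real.cos θ)) := by
  rw [Complex.norm_exp, ← Real.exp_add, logArg, mul_add, Complex.add_re, Complex.re_mul_ofReal]
  gcongr
  refine (Complex.re_le_norm _).trans ?_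
  rw [norm_mul]
  gcongr

theorem norm_negI_mul_le (z : ℂ) (θ : ℝ) :
    ‖-Complex.I * z * (1 + Real.cos θ)‖ ≤ 2 * ‖z‖ := by
  have h : ‖(1 + Real.cos θ : ℂ)‖ ≤ 2 := by
    rw [← Complex.ofReal_one, ← Complex.ofReal_add, Complex.norm_real, Real.norm_eq_abs, abs_le]
    constructor <;> linarith [Real.neg_one_le_cos θ, Real.cos_le_one θ]
  rw [norm_mul, norm_mul, norm_neg, Complex.norm_I, one_mul, mul_comm]
  gcongr

theorem exists_norm_exp_mul_normGammaP_le {z : ℂ} (hz : z ≠ 0) (R : ℝ) : ∃ C : ℝ, 0 ≤ C ∧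
    ∀ ν : ℂ, ‖ν‖ ≤ R → -1 < ν.re → ∀ θ ∈ Set.Ioo (-Real.pi) Real.pi,
      ‖Complex.exp (-Complex.I * z * Real.cos θ) * normGammaP ν (logArg z θ)‖ ≤
        C * Real.exp (ν.re * Real.log (1 + Real.cos θ)) := by
  obtain ⟨C, hC0, hC⟩ := exists_norm_rgSeries_le R (2 * ‖z‖)
  refine ⟨‖Complex.exp (Complex.I * z)‖ * Real.exp (R * ‖logNegI z‖) * C, by positivity,
    fun ν hν hre θ hθ => ?_⟩
  rw [exp_mul_normGammaP hz hθ hre, norm_mul, norm_mul]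
  calc _ ≤ ‖Complex.exp (Complex.I * z)‖ * (Real.exp (R * ‖logNegI z‖) *
      Real.exp (ν.re * Real.log (1 + Real.cos θ))) * C := by
        gcongr
        · exact norm_exp_mul_logArg_le hν θ
        · exact hC ν _ hν (norm_negI_mul_le z θ)
    _ = _ := by ring

theorem ae_uIoc_mem_Ioo {p : ℝ → Prop} (h : ∀ θ ∈ Set.Ioo 0 Real.pi, p θ) :
    ∀ᵐ θ : ℝ ∂volume, θ ∈ Set.uIoc 0 Real.pi → p θ := by
  have h0 : ∀ᵐ θ : ℝ ∂volume, θ ≠ Real.pi := by simp [ae_iff]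
  filter_upwards [h0] with θ hθ hmem
  rw [Set.uIoc_of_le Real.pi_pos.le] at hmem
  exact h θ ⟨hmem.1, lt_of_le_of_ne hmem.2 hθ⟩

theorem Ioo_zero_pi_subset : Set.Ioo 0 Real.pi ⊆ Set.Ioo (-Real.pi) Real.pi :=
  Set.Ioo_subset_Ioo_left (by linarith [Real.pi_pos])

theorem intervalIntegrable_exp_mul_normGammaP {z : ℂ} (hz : z ≠ 0) {ν : ℂ} (hν : -1 / 2 < ν.re) :
    IntervalIntegrable (fun θ : ℝ => Complex.exp (-Complex.I * z * Real.cos θ) *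
      normGammaP ν (logArg z θ)) volume 0 Real.pi := by
  obtain ⟨C, -, hC⟩ := exists_norm_exp_mul_normGammaP_le hz ‖ν‖
  refine ((intervalIntegrable_exp_mul_log_one_add_cos hν).const_mul C).mono_fun'
    (measurable_exp_mul_normGammaP z (by linarith)).aestronglyMeasurable ?_
  exact (ae_restrict_iff' measurableSet_uIoc).2 (ae_uIoc_mem_Ioo fun θ hθ =>
    hC ν le_rfl (by linarith) θ (Ioo_zero_pi_subset hθ))

theorem intervalIntegrable_exp_mul_normGammaP_mul_cos {z : ℂ} (hz : z ≠ 0) {ν : ℂ}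
    (hν : -1 / 2 < ν.re) (μ : ℂ) :
    IntervalIntegrable (fun θ : ℝ => Complex.exp (-Complex.I * z * Real.cos θ) *
      normGammaP ν (logArg z θ) * Complex.cos (μ * θ)) volume 0 Real.pi :=
  (intervalIntegrable_exp_mul_normGammaP hz hν).mul_continuousOn (by fun_prop)

theorem intervalIntegrable_integrandB {z : ℂ} (hz : z ≠ 0) (μ : ℂ) :
    IntervalIntegrable (integrandB μ z) volume 0 Real.pi :=
  intervalIntegrable_exp_mul_normGammaP_mul_cos hz (neg_half_lt_fracPart_re μ) μ

/-- Dominated convergence allows termwise integration, since `‖w‖ ≤ 2‖z‖`. The Cauchy integral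
applies to the `k`-th term with `b = 2(ν+k)` and `l = k - n`, because then `b/2 - l = ν + n` is
independent of `k`. -/
theorem hasSum_integral_normGammaP {z : ℂ} (hz : z ≠ 0) {ν : ℂ} (hν : -1 / 2 < ν.re) (n : ℤ) :
    HasSum (fun k : ℕ => Complex.exp (Complex.I * z) * ((Complex.Gamma (ν + k + 1))⁻¹ *
        Complex.exp ((ν + k) * (logNegI z - Real.log 2)) * (fourierBinom (2 * (ν + k)) (k - n) / 2)))
      (∫ θ in (0 : ℝ)..Real.pi, Complex.exp (-Complex.I * z * Real.cos θ) *
        normGammaP ν (logArg z θ) * Complex.cos ((ν + n) * θ)) := by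
  set F : ℕ → ℝ → ℂ := fun k θ => Complex.exp (Complex.I * z) * Complex.exp (ν * logArg z θ) *
    ((-Complex.I * z * (1 + Real.cos θ)) ^ k * (Complex.Gamma (ν + k + 1))⁻¹) *
      Complex.cos ((ν + n) * θ) with hF
  set c : ℕ → ℝ := fun k => ‖((2 * ‖z‖ : ℝ) : ℂ) ^ k * (Complex.Gamma (ν + k + 1))⁻¹‖ with hc
  have hcs : Summable c := summable_norm_rgSeries ν _
  have hmeasL := measurable_logArg z
  have hbase : IntervalIntegrable (fun θ : ℝ => ‖Complex.exp (Complex.I * z) *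
      Complex.exp (ν * logArg z θ) * Complex.cos ((ν + n) * θ)‖) volume 0 Real.pi := by
    refine IntervalIntegrable.norm (IntervalIntegrable.mul_continuousOn
      (IntervalIntegrable.const_mul ?_ _) (by fun_prop))
    refine ((intervalIntegrable_exp_mul_log_one_add_cos hν).const_mul
      (Real.exp (‖ν‖ * ‖logNegI z‖))).mono_fun' (Measurable.aestronglyMeasurable (by fun_prop)) ?_
    exact Eventually.of_forall fun θ => norm_exp_mul_logArg_le le_rfl θ
  have key := intervalIntegral.hasSum_integral_of_dominated_convergence (μ := volume)
    (a := 0) (b := Real.pi) (F := F)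
    (f := fun θ : ℝ => Complex.exp (-Complex.I * z * Real.cos θ) *
        normGammaP ν (logArg z θ) * Complex.cos ((ν + n) * θ))
    (fun k θ => ‖Complex.exp (Complex.I * z) * Complex.exp (ν * logArg z θ) *
      Complex.cos ((ν + n) * θ)‖ * c k)
    (fun k => Measurable.aestronglyMeasurable (by rw [hF]; fun_prop))
    (fun k => Eventually.of_forall fun θ _ => ?_)
    (Eventually.of_forall fun θ _ => hcs.mul_left _)
    (by simp only [tsum_mul_left]; exact hbase.mul_const _)
    (ae_uIoc_mem_Ioo fun θ hθ => ?_)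
  · have hval (k : ℕ) : ∫ θ in (0 : ℝ)..Real.pi, F k θ = Complex.exp (Complex.I * z) *
        ((Complex.Gamma (ν + k + 1))⁻¹ * Complex.exp ((ν + k) * (logNegI z - Real.log 2)) *
          (fourierBinom (2 * (ν + k)) (k - n) / 2)) := by
      have h1 : ∫ θ in (0 : ℝ)..Real.pi, F k θ = ∫ θ in (0 : ℝ)..Real.pi,
          Complex.exp (Complex.I * z) * (Complex.Gamma (ν + k + 1))⁻¹ *
            Complex.exp ((ν + k) * logNegI z) *
            (Complex.exp (2 * (ν + k) / 2 * Real.log (1 + Real.cos θ)) *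
              Complex.cos ((2 * (ν + k) / 2 - (k - n : ℤ)) * θ)) := by
        refine intervalIntegral.integral_congr_ae (ae_uIoc_mem_Ioo fun θ hθ => ?_)
        have h2 : Complex.exp (ν * logArg z θ) * (-Complex.I * z * (1 + Real.cos θ)) ^ k =
            Complex.exp ((ν + k) * logNegI z) *
              Complex.exp (2 * (ν + k) / 2 * Real.log (1 + Real.cos θ)) := by
          rw [← exp_logArg hz (Ioo_zero_pi_subset hθ), ← Complex.exp_nat_mul, ← Complex.exp_add,
            ← Complex.exp_add, logArg]
          congr 1; ring
        have h3 : 2 * (ν + k) / 2 - ((k - n : ℤ) : ℂ) = ν + n := by push_cast; ring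
        simp only [hF]
        rw [h3]
        linear_combination Complex.exp (Complex.I * z) * (Complex.Gamma (ν + k + 1))⁻¹ *
          Complex.cos ((ν + n) * θ) * h2
      have hre : -1 < (2 * (ν + k)).re := by
        have h0 : (0 : ℝ) ≤ k := k.cast_nonneg
        simp; linarith
      have h4 : Complex.exp ((ν + k) * (logNegI z - Real.log 2)) = Complex.exp ((ν + k) * logNegI z) *
          Complex.exp (-(2 * (ν + k) / 2 * Real.log 2)) := by
        rw [← Complex.exp_add]; congr 1; ring
      rw [h1, intervalIntegral.integral_const_mul, integral_exp_mul_cos hre, h4]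
      ring
    simpa only [hval] using key
  · simp only [hF, hc]
    have h1 : ‖(-Complex.I * z * (1 + Real.cos θ)) ^ k‖ ≤ ‖((2 * ‖z‖ : ℝ) : ℂ) ^ k‖ := by
      rw [norm_pow, norm_pow, Complex.norm_real, Real.norm_of_nonneg (by positivity)]
      exact pow_le_pow_left₀ (norm_nonneg _) (norm_negI_mul_le z θ) k
    calc _ = ‖Complex.exp (Complex.I * z) * Complex.exp (ν * logArg z θ) *
        Complex.cos ((ν + n) * θ)‖ * (‖(-Complex.I * z * (1 + Real.cos θ)) ^ k‖ *
          ‖(Complex.Gamma (ν + k + 1))⁻¹‖) := by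
          simp only [norm_mul]; ring
      _ ≤ _ := by
          rw [norm_mul (((2 * ‖z‖ : ℝ) : ℂ) ^ k)]
          gcongr
  · rw [exp_mul_normGammaP hz (Ioo_zero_pi_subset hθ) (by linarith)]
    exact ((summable_norm_rgSeries ν _).of_norm.hasSum.mul_left _).mul_right _

/-- The choice `arg(-iz) = arg z - π/2` makes `log i` cancel exactly against the shift of the
logarithm, with no multiple of `2πi` left over. -/
theorem I_cpow_mul_exp {z : ℂ} (hz : z ≠ 0) (μ : ℂ) (l : ℕ) :
    Complex.I ^ μ * Complex.exp ((μ + l) * (logNegI z - Real.log 2)) =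
      (z / 2) ^ μ * (-Complex.I * z / 2) ^ l := by
  have hl : Complex.log (z / 2) = Complex.log z - Real.log 2 := by
    have := Complex.log_ofReal_mul (r := 1 / 2) (by norm_num) hz
    rw [show ((1 / 2 : ℝ) : ℂ) * z = z / 2 by push_cast; ring] at this
    rw [this, one_div, Real.log_inv]; push_cast; ring
  have h2 : -Complex.I * z / 2 = Complex.exp (logNegI z - Real.log 2) := by
    rw [Complex.exp_sub, exp_logNegI hz, ← Complex.ofReal_exp, Real.exp_log (by norm_num)]
    push_cast; ring
  rw [Complex.cpow_def_of_ne_zero Complex.I_ne_zero, Complex.cpow_def_of_ne_zero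
    (div_ne_zero hz two_ne_zero), h2, ← Complex.exp_nat_mul, ← Complex.exp_add, ← Complex.exp_add,
    Complex.log_I, hl, logNegI]
  congr 1
  ring

theorem hasSum_B {z : ℂ} (hz : z ≠ 0) (μ : ℂ) :
    HasSum (fun k : ℕ => Complex.I ^ μ / Real.pi * (Complex.exp (Complex.I * z) *
      ((Complex.Gamma (fracPart μ + k + 1))⁻¹ *
        Complex.exp ((fracPart μ + k) * (logNegI z - Real.log 2)) *
          (fourierBinom (2 * (fracPart μ + k)) (k - nearestInt μ.re) / 2)))) (B μ z) := by
  have h := hasSum_integral_normGammaP hz (neg_half_lt_fracPart_re μ) (nearestInt μ.re)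
  have h1 : fracPart μ + nearestInt μ.re = μ := by rw [fracPart]; ring
  rw [h1] at h
  exact h.mul_left _

theorem besselJ_eq_B_add_chi {z : ℂ} (hz : z ≠ 0) (μ : ℂ) : besselJ μ z = B μ z + chi μ z := by
  set n := nearestInt μ.re with hn
  have hfr : fracPart μ = μ - n := rfl
  have hB := hasSum_B hz μ
  have hpi : (Real.pi : ℂ) ≠ 0 := Complex.ofReal_ne_zero.2 Real.pi_ne_zero
  set G : ℕ → ℂ := fun l => (z / 2) ^ μ * Complex.exp (Complex.I * z) *
    (kummerCoeff μ l * (-Complex.I * z / 2) ^ l) with hG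
  have hJ : besselJ μ z = ∑' l, G l := by rw [besselJ_eq, ← tsum_mul_left]
  -- The `k`-th term of `B` is the Kummer term of index `l = k - n` whenever this is nonnegative.
  have hterm (k l : ℕ) (hkl : (k : ℤ) - n = l) :
      Complex.I ^ μ / Real.pi * (Complex.exp (Complex.I * z) *
      ((Complex.Gamma (fracPart μ + k + 1))⁻¹ *
        Complex.exp ((fracPart μ + k) * (logNegI z - Real.log 2)) *
          (fourierBinom (2 * (fracPart μ + k)) (k - n) / 2))) = G l := by
    have h1 : fracPart μ + k = μ + l := by
      rw [hfr]
      have : (((k : ℤ) - n : ℤ) : ℂ) = l := by rw [hkl]; simp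
      push_cast at this
      linear_combination this
    have h2 : -1 < (2 * (μ + l)).re := by
      rw [← h1]
      have h0 : (0 : ℝ) ≤ k := k.cast_nonneg
      have := neg_half_lt_fracPart_re μ
      simp; linarith
    rw [h1, hkl, fourierBinom_natCast h2]
    simp only [hG, kummerCoeff]
    have h3 := I_cpow_mul_exp hz μ l
    have h4 : (Real.pi : ℂ)⁻¹ * Real.pi = 1 := inv_mul_cancel₀ hpi
    generalize ∏ i ∈ Finset.range l, (2 * (μ + l) - (i : ℂ)) = p
    generalize (Complex.Gamma (μ + l + 1))⁻¹ = g
    generalize Complex.exp ((μ + l) * (logNegI z - Real.log 2)) = e at h3 ⊢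
    linear_combination Complex.exp (Complex.I * z) * p / l.factorial * g * h3 +
      Complex.I ^ μ * Complex.exp (Complex.I * z) * g * e * p / l.factorial * h4
  rcases lt_or_ge (-1 / 2) μ.re with hre | hre
  · have hn0 : 0 ≤ n := by
      rw [hn, nearestInt]; exact Int.ceil_nonneg_of_neg_one_lt (by linarith)
    obtain ⟨N, hN⟩ := Int.eq_ofNat_of_zero_le hn0
    rw [chi, if_neg (not_le.2 hre), add_zero, hJ, ← hB.tsum_eq, ← hB.summable.sum_add_tsum_nat_add N,
      Finset.sum_eq_zero, zero_add]
    · exact tsum_congr fun l => (hterm (l + N) l (by rw [hN]; push_cast; ring)).symm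
    -- For `k < n` the Fourier index `k - n` is negative, so these terms of `B` are zero.
    · intro k hk
      have hk' := Finset.mem_range.1 hk
      have h2 : -1 < (2 * (fracPart μ + k)).re := by
        have h0 : (0 : ℝ) ≤ k := k.cast_nonneg
        have := neg_half_lt_fracPart_re μ
        simp; linarith
      have := fourierBinom_neg h2 (N - k - 1)
      rw [show (-((N - k - 1 + 1 : ℕ) : ℤ)) = (k : ℤ) - n by omega] at this
      rw [← hn, this]
      simp
  · have hn0 : n ≤ -1 := by
      rw [hn, nearestInt]; apply Int.ceil_le.2; push_cast; linarith
    obtain ⟨N, hN⟩ := Int.eq_ofNat_of_zero_le (show 0 ≤ -n by omega)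
    -- With `n = -N < 0` the integral gives only the tail `l ≥ N`; the first `N` Kummer terms must
    -- be `χ`, under `j = l + 1`.
    have hB' : HasSum (fun k => G (k + N)) (B μ z) :=
      hB.congr_fun fun k => (hterm k (k + N) (by push_cast; omega)).symm
    have hs : Summable G := (summable_nat_add_iff N).1 hB'.summable
    have hIcc : Finset.Icc 1 N = Finset.Ico (0 + 1) (N + 1) := by ext; simp
    rw [hJ, ← hs.sum_add_tsum_nat_add N, hB'.tsum_eq, add_comm, chi, if_pos hre, ← hn, hN,
      Int.toNat_natCast, Finset.mul_sum, Finset.range_eq_Ico, hIcc,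
      ← Finset.sum_Ico_add' _ 0 N 1]
    congr 1
    refine Finset.sum_congr rfl fun l hl => ?_
    have hlN := (Finset.mem_Ico.1 hl).2
    have hbound : μ.re + l ≤ -1 / 2 := by
      have h1 : (n : ℝ) + l ≤ -1 := by exact_mod_cast (show n + l ≤ -1 by omega)
      have h2 := sub_half_le_nearestInt (x := μ.re)
      rw [← hn] at h2
      linarith
    have h3 := I_cpow_mul_exp hz μ l
    -- `(-2iz)^{μ+l} = 4^{μ+l} (-iz/2)^{μ+l}` on the same branch.
    have h4 : Complex.exp (((l + 1 : ℕ) + μ - 1) * ((Real.log 2 : ℝ) + logNegI z)) =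
        Complex.exp (2 * (μ + l) * Real.log 2) *
          Complex.exp ((μ + l) * (logNegI z - Real.log 2)) := by
      rw [← Complex.exp_add]; congr 1; push_cast; ring
    simp only [hG]
    rw [h4, kummerCoeff_eq_gammaQuotient hbound]
    linear_combination -Complex.exp (Complex.I * z) *
      (Complex.exp (2 * (μ + l) * Real.log 2) / (Real.sqrt Real.pi : ℝ) *
        (gammaQuotient μ (l + 1) / Complex.Gamma (l + 1 : ℕ))) * h3

/-! ### Complementarity and the derivative of `P` in its parameter -/

theorem rgSeries_sub_one (ν w : ℂ) :
    rgSeries (ν - 1) w = (Complex.Gamma ν)⁻¹ + w * rgSeries ν w := by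
  rw [rgSeries, (summable_norm_rgSeries (ν - 1) w).of_norm.tsum_eq_zero_add, rgSeries,
    ← tsum_mul_left]
  congr 1
  · simp
  · refine tsum_congr fun k => ?_
    rw [show ν - 1 + ((k + 1 : ℕ) : ℂ) + 1 = ν + k + 1 by push_cast; ring, pow_succ]
    ring

theorem mul_deriv_rgSeries (ν w : ℂ) :
    w * deriv (rgSeries ν) w = rgSeries (ν - 1) w - ν * rgSeries ν w := by
  obtain ⟨C, -, hC⟩ := exists_norm_inv_Gamma_le ‖ν‖
  have hmem : w ∈ Metric.ball (0 : ℂ) (‖w‖ + 1) := by simp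
  have hd := Complex.hasSum_deriv_of_summable_norm
    (F := fun (k : ℕ) (y : ℂ) => y ^ k * (Complex.Gamma (ν + k + 1))⁻¹)
    ((summable_norm_pow_mul_factorial ((‖w‖ + 1 : ℝ) : ℂ)).mul_left C)
    (fun k => ((differentiable_id.pow k).mul_const _).differentiableOn)
    Metric.isOpen_ball (fun k y hy => by
      rw [norm_mul, mul_left_comm, norm_pow, norm_pow]
      have h1 : ‖y‖ ≤ ‖((‖w‖ + 1 : ℝ) : ℂ)‖ := by
        rw [Complex.norm_real]; exact (mem_ball_zero_iff.1 hy).le.trans (le_abs_self _)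
      gcongr
      exact hC ν le_rfl k) hmem
  have hs := (summable_norm_rgSeries ν w).of_norm.hasSum.mul_left ν
  have hs' := (summable_norm_rgSeries (ν - 1) w).of_norm.hasSum
  have hsum := (hd.mul_left w).add hs
  have heq : (fun k : ℕ => w * deriv (fun y : ℂ => y ^ k * (Complex.Gamma (ν + k + 1))⁻¹) w +
      ν * (w ^ k * (Complex.Gamma (ν + k + 1))⁻¹)) =
      fun k : ℕ => w ^ k * (Complex.Gamma (ν - 1 + k + 1))⁻¹ := by
    funext k
    rw [deriv_mul_const (by fun_prop), deriv_pow_field,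
      Complex.one_div_Gamma_eq_self_mul_one_div_Gamma_add_one (ν - 1 + k + 1),
      show ν - 1 + (k : ℂ) + 1 + 1 = ν + k + 1 by ring]
    cases k with
    | zero => simp
    | succ k => rw [Nat.add_sub_cancel, pow_succ]; push_cast; ring
  rw [heq] at hsum
  exact eq_sub_of_add_eq (hsum.unique hs')

/-- On the Riemann surface, with `w = e^s`, this is `dP = w^{ν-1} e^{-w} dw / Γ(ν)`. The relation `w
R_ν' + ν R_ν = R_{ν-1} = 1/Γ(ν) + w R_ν` for the series `R_ν` reduces the derivative to this form.
-/
theorem hasDerivAt_normGammaP {ν : ℂ} (hν : -1 < ν.re) (s : ℂ) :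
    HasDerivAt (normGammaP ν) ((Complex.Gamma ν)⁻¹ * Complex.exp (ν * s - Complex.exp s)) s := by
  have h : normGammaP ν = fun s =>
      Complex.exp (ν * s) * (Complex.exp (-Complex.exp s) * rgSeries ν (Complex.exp s)) :=
    funext fun s => normGammaP_eq hν s
  rw [h]
  have h1 : HasDerivAt (fun s => Complex.exp (ν * s)) (Complex.exp (ν * s) * ν) s := by
    simpa using ((hasDerivAt_id s).const_mul ν).cexp
  have h2 : HasDerivAt (fun s => Complex.exp (-Complex.exp s))
      (Complex.exp (-Complex.exp s) * -Complex.exp s) s := (Complex.hasDerivAt_exp s).neg.cexp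
  have h3 := (differentiable_rgSeries_right ν (Complex.exp s)).hasDerivAt.comp s
    (Complex.hasDerivAt_exp s)
  refine (h1.mul (h2.mul h3)).congr_deriv ?_
  have h4 := mul_deriv_rgSeries ν (Complex.exp s)
  rw [rgSeries_sub_one] at h4
  rw [sub_eq_add_neg, Complex.exp_add]
  simp only [Pi.mul_apply, Function.comp_apply]
  change _ + _ * (_ + _ * (deriv (rgSeries ν) (Complex.exp s) * _)) = _
  linear_combination Complex.exp (ν * s) * Complex.exp (-Complex.exp s) * h4

theorem Gamma_integrand_eq (ν : ℂ) (σ : ℝ) :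
    |Real.exp σ| • ((Real.exp (-Real.exp σ) : ℂ) * (Real.exp σ : ℂ) ^ (ν - 1)) =
      Complex.exp (ν * σ - Complex.exp σ) := by
  rw [Real.abs_exp, Complex.real_smul, Complex.cpow_def_of_ne_zero (by simp), ← Complex.ofReal_log
    (Real.exp_pos σ).le, Real.log_exp, Complex.ofReal_exp, Complex.ofReal_exp, ← Complex.exp_add,
    ← Complex.exp_add, Complex.ofReal_neg, Complex.ofReal_exp]
  congr 1; ring

theorem integrable_Gamma_integrand {ν : ℂ} (hν : 0 < ν.re) :
    Integrable fun σ : ℝ => Complex.exp (ν * σ - Complex.exp σ) := by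
  have h := (integrableOn_image_iff_integrableOn_abs_deriv_smul MeasurableSet.univ
    (fun x _ => (Real.hasDerivAt_exp x).hasDerivWithinAt) Real.exp_injective.injOn
    (fun x : ℝ => (Real.exp (-x) : ℂ) * (x : ℂ) ^ (ν - 1))).1 (by
      rw [Set.image_univ, Real.range_exp]; exact Complex.GammaIntegral_convergent hν)
  simp only [Gamma_integrand_eq] at h
  exact integrableOn_univ.1 h

theorem integral_Gamma_integrand {ν : ℂ} (hν : 0 < ν.re) :
    ∫ σ : ℝ, Complex.exp (ν * σ - Complex.exp σ) = Complex.Gamma ν := by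
  have h := integral_image_eq_integral_abs_deriv_smul MeasurableSet.univ
    (fun x _ => (Real.hasDerivAt_exp x).hasDerivWithinAt) Real.exp_injective.injOn
    (fun x : ℝ => (Real.exp (-x) : ℂ) * (x : ℂ) ^ (ν - 1))
  simp only [Gamma_integrand_eq] at h
  rw [Set.image_univ, Real.range_exp, setIntegral_univ] at h
  rw [← h, Complex.Gamma_eq_integral hν, Complex.GammaIntegral]

/-- The point `s = 0` is `w = 1`. The derivative of `P` is integrated from `-∞`, where `e^{νσ}`, and
with it `P`, tends to zero as `Re ν > 0`. -/
theorem normGammaP_zero_right {ν : ℂ} (hν : 0 < ν.re) :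
    normGammaP ν 0 = (Complex.Gamma ν)⁻¹ *
      ∫ σ in Set.Iic (0 : ℝ), Complex.exp (ν * σ - Complex.exp σ) := by
  have hlim : Tendsto (fun σ : ℝ => normGammaP ν σ) atBot (𝓝 0) := by
    have h1 : Tendsto (fun σ : ℝ => Complex.exp (ν * σ)) atBot (𝓝 0) := by
      rw [tendsto_zero_iff_norm_tendsto_zero]
      have : Tendsto (fun σ : ℝ => ν.re * σ) atBot atBot := tendsto_id.const_mul_atBot hν
      refine (Real.tendsto_exp_atBot.comp this).congr fun σ => ?_
      rw [Complex.norm_exp, Complex.re_mul_ofReal]; rfl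
    have h2 : Tendsto (fun σ : ℝ => Complex.exp σ) atBot (𝓝 0) := by
      rw [tendsto_zero_iff_norm_tendsto_zero]
      refine Real.tendsto_exp_atBot.congr fun σ => ?_
      rw [Complex.norm_exp, Complex.ofReal_re]
    have h3 : Continuous fun w => Complex.exp (-w) * rgSeries ν w :=
      (Complex.continuous_exp.comp continuous_neg).mul (differentiable_rgSeries_right ν).continuous
    have h4 := h1.mul ((h3.tendsto 0).comp h2)
    rw [zero_mul] at h4
    exact h4.congr fun σ => (normGammaP_eq (by linarith) σ).symm
  have hd (σ : ℝ) : HasDerivAt (fun σ : ℝ => normGammaP ν σ)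
      ((Complex.Gamma ν)⁻¹ * Complex.exp (ν * σ - Complex.exp σ)) σ :=
    (hasDerivAt_normGammaP (by linarith) (σ : ℂ)).comp_ofReal
  have h := integral_Iic_of_hasDerivAt_of_tendsto (a := 0)
    (hd 0).continuousAt.continuousWithinAt (fun σ _ => hd σ)
    ((integrable_Gamma_integrand hν).integrableOn.const_mul _) hlim
  rw [integral_const_mul, sub_zero, Complex.ofReal_zero] at h
  exact h.symm

/-- The lower and the upper incomplete gamma functions are complementary. -/
theorem normGammaP_eq_one_sub {ν : ℂ} (hν : 0 < ν.re) (s : ℂ) :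
    normGammaP ν s = 1 - (Complex.Gamma ν)⁻¹ * upperGamma ν s := by
  have hG : Complex.Gamma ν ≠ 0 := Complex.Gamma_ne_zero_of_re_pos hν
  have hint := integrable_Gamma_integrand hν
  have h1 := intervalIntegral.integral_Iic_add_Ioi hint.integrableOn (hint.integrableOn
    (s := Set.Ioi 0)) (b := 0)
  rw [integral_Gamma_integrand hν] at h1
  -- From `w = 1` the value is continued along the segment from `0` to `s`, the same path as in
  -- `upperGamma`; thus no branch question arises.
  have hd (τ : ℝ) : HasDerivAt (fun τ : ℝ => normGammaP ν (τ * s))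
      ((Complex.Gamma ν)⁻¹ * s * Complex.exp (ν * (τ * s) - Complex.exp (τ * s))) τ := by
    have := ((hasDerivAt_normGammaP (by linarith) ((τ : ℂ) * s)).comp (τ : ℂ)
      ((hasDerivAt_id (τ : ℂ)).mul_const s)).comp_ofReal
    refine this.congr_deriv ?_
    ring
  have h2 := intervalIntegral.integral_eq_sub_of_hasDerivAt (a := 0) (b := 1) (fun τ _ => hd τ)
    (Continuous.intervalIntegrable (by fun_prop) _ _)
  rw [intervalIntegral.integral_const_mul, Complex.ofReal_one, one_mul, Complex.ofReal_zero,
    zero_mul, normGammaP_zero_right hν] at h2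
  rw [upperGamma]
  have h3 : (Complex.Gamma ν)⁻¹ * Complex.Gamma ν = 1 := inv_mul_cancel₀ hG
  linear_combination -h2 + h3 + (Complex.Gamma ν)⁻¹ * h1

theorem integrableOn_exp_sub_exp :
    IntegrableOn (fun σ : ℝ => Real.exp (σ - Real.exp σ)) (Set.Ioi 0) := by
  have h := (integrable_Gamma_integrand (ν := 1) (by simp)).norm.integrableOn (s := Set.Ioi 0)
  refine h.congr_fun (fun σ _ => ?_) measurableSet_Ioi
  dsimp only
  rw [one_mul, Complex.norm_exp, ← Complex.ofReal_exp, ← Complex.ofReal_sub, Complex.ofReal_re]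

theorem continuous_upperGamma_zero : Continuous (upperGamma 0) := by
  unfold upperGamma
  refine continuous_const.sub (continuous_id.mul ?_)
  refine intervalIntegral.continuous_parametric_intervalIntegral_of_continuous' ?_ 0 1
  fun_prop

theorem tendsto_upperGamma_zero (s : ℂ) :
    Tendsto (fun x : ℝ => upperGamma x s) (𝓝[>] 0) (𝓝 (upperGamma 0 s)) := by
  unfold upperGamma
  refine Tendsto.sub ?_ (Tendsto.const_mul s ?_)
  · refine tendsto_integral_filter_of_dominated_convergence (fun σ => Real.exp (σ - Real.exp σ))
      (Eventually.of_forall fun x => Continuous.aestronglyMeasurable (by fun_prop)) ?_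
      integrableOn_exp_sub_exp (Eventually.of_forall fun σ => ?_)
    · have : ∀ᶠ x : ℝ in 𝓝[>] 0, x ≤ 1 :=
        mem_nhdsWithin_of_mem_nhds (Iic_mem_nhds one_pos)
      filter_upwards [this] with x hx
      refine (ae_restrict_iff' measurableSet_Ioi).2 (Eventually.of_forall fun σ hσ => ?_)
      rw [Complex.norm_exp, ← Complex.ofReal_exp, ← Complex.ofReal_mul, ← Complex.ofReal_sub,
        Complex.ofReal_re]
      have : x * σ ≤ 1 * σ := mul_le_mul_of_nonneg_right hx (le_of_lt hσ)
      gcongr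
      linarith
    · have : Continuous fun x : ℝ => Complex.exp (x * σ - Complex.exp σ) := by fun_prop
      have h := this.tendsto 0
      rw [Complex.ofReal_zero] at h
      exact h.mono_left nhdsWithin_le_nhds
  · have : Continuous fun x : ℝ => ∫ τ in (0 : ℝ)..1,
        Complex.exp (x * (τ * s) - Complex.exp (τ * s)) :=
      intervalIntegral.continuous_parametric_intervalIntegral_of_continuous' (by fun_prop) 0 1
    have h := this.tendsto 0
    rw [Complex.ofReal_zero] at h
    exact h.mono_left nhdsWithin_le_nhds

theorem differentiableAt_normGammaP_left {ν : ℂ} (hν : -1 < ν.re) (s : ℂ) :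
    DifferentiableAt ℂ (fun ν => normGammaP ν s) ν := by
  have h : DifferentiableAt ℂ (fun ν => Complex.exp (ν * s) *
      (Complex.exp (-Complex.exp s) * rgSeries ν (Complex.exp s))) ν :=
    DifferentiableAt.mul (by fun_prop)
      ((differentiable_rgSeries_left (Complex.exp s) ν).const_mul _)
  refine h.congr_of_eventuallyEq ?_
  filter_upwards [(isOpen_lt continuous_const Complex.continuous_re).mem_nhds hν] with x hx
  exact normGammaP_eq hx s

theorem normGammaP_zero_left (s : ℂ) : normGammaP 0 s = 1 := by
  rw [normGammaP, gammaStar_zero, zero_mul, Complex.exp_zero, one_mul]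

/-- `P` is analytic in the parameter near `0`, so the derivative exists and can be computed along
positive reals `x`. There `P(x) - P(0) = -Γ(x, ·)/Γ(x) = -x Γ(x, ·)/Γ(x+1)`. -/
theorem hasDerivAt_normGammaP_left_zero (s : ℂ) :
    HasDerivAt (fun ν => normGammaP ν s) (-upperGamma 0 s) 0 := by
  have h := (differentiableAt_normGammaP_left (ν := 0) (by simp) s).hasDerivAt
  have hmap : Tendsto (fun x : ℝ => (x : ℂ)) (𝓝[>] 0) (𝓝[≠] 0) := by
    refine tendsto_nhdsWithin_iff.2 ⟨?_, ?_⟩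
    · have := Complex.continuous_ofReal.tendsto 0
      rw [Complex.ofReal_zero] at this
      exact this.mono_left nhdsWithin_le_nhds
    · filter_upwards [self_mem_nhdsWithin] with x hx
      exact Complex.ofReal_ne_zero.2 (ne_of_gt hx)
  have h1 := h.tendsto_slope.comp hmap
  have hG : Tendsto (fun x : ℝ => -(Complex.Gamma (x + 1))⁻¹ * upperGamma x s) (𝓝[>] 0)
      (𝓝 (-upperGamma 0 s)) := by
    have h2 : Continuous fun x : ℝ => -(Complex.Gamma (x + 1))⁻¹ :=
      (Complex.differentiable_one_div_Gamma.continuous.comp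
        (by fun_prop : Continuous fun x : ℝ => (x : ℂ) + 1)).neg
    have h3 := (h2.tendsto 0).mono_left (nhdsWithin_le_nhds (s := Set.Ioi 0))
    have h4 := h3.mul (tendsto_upperGamma_zero s)
    simpa using h4
  have h2 : Tendsto (slope (fun ν => normGammaP ν s) 0 ∘ fun x : ℝ => (x : ℂ)) (𝓝[>] 0)
      (𝓝 (-upperGamma 0 s)) := by
    refine hG.congr' ?_
    filter_upwards [self_mem_nhdsWithin] with x hx
    have hx0 : (x : ℂ) ≠ 0 := Complex.ofReal_ne_zero.2 (ne_of_gt hx)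
    rw [Function.comp_apply, slope_def_field, normGammaP_zero_left,
      normGammaP_eq_one_sub (by simpa using hx), Complex.Gamma_add_one _ hx0, mul_inv]
    field_simp
    ring
  rw [tendsto_nhds_unique h2 h1]
  exact h

/-! ### Continuity at integral order -/

theorem integrandB_intCast (z : ℂ) (θ : ℝ) (m : ℤ) : integrandB m z θ =
    Complex.exp (-Complex.I * z * Real.cos θ) * Complex.cos (m * θ) := by
  have h : fracPart (m : ℂ) = 0 := by
    rw [fracPart, nearestInt_eq (n := m)] <;> simp
  rw [integrandB, h, normGammaP_zero_left, mul_one]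

/-- For `j ≤ -m` and `m < 0` the number `j + 2m ≤ m` is a pole of `Γ`, so every summand has the
factor `1/Γ(j+2m) = 0`. -/
theorem chi_intCast (m : ℤ) (z : ℂ) : chi m z = 0 := by
  rw [chi]
  split_ifs with h
  · have hn : nearestInt (m : ℂ).re = m := nearestInt_eq (by simp) (by simp)
    rw [Finset.sum_eq_zero, mul_zero]
    intro j hj
    rw [hn] at hj
    have hj' := Finset.mem_Icc.1 hj
    have hex : ¬ ∃ k : ℤ, k ≤ -1 ∧ (m : ℂ) = k + 1 / 2 := by
      rintro ⟨k, -, hk⟩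
      have h1 : ((2 * m : ℤ) : ℂ) = ((2 * k + 1 : ℤ) : ℂ) := by
        push_cast; linear_combination 2 * hk
      have h2 := Int.cast_injective h1
      omega
    have hG : Complex.Gamma (j + 2 * (m : ℂ)) = 0 := by
      rw [Complex.Gamma_eq_zero_iff]
      refine ⟨(-(j + 2 * m)).toNat, ?_⟩
      have h5 : (((-(j + 2 * m)).toNat : ℤ) : ℂ) = ((-(j + 2 * m) : ℤ) : ℂ) := by
        rw [Int.toNat_of_nonneg (by omega)]
      rw [Int.cast_natCast] at h5
      rw [h5]; push_cast; ring
    rw [gammaQuotient, if_neg hex, hG]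
    simp
  · rfl

/-- Bessel's integral. -/
theorem besselJ_intCast {z : ℂ} (hz : z ≠ 0) (m : ℤ) : besselJ m z = Complex.I ^ m / Real.pi *
    ∫ θ in (0 : ℝ)..Real.pi, Complex.exp (-Complex.I * z * Real.cos θ) * Complex.cos (m * θ) := by
  rw [besselJ_eq_B_add_chi hz, chi_intCast, add_zero, B, Complex.cpow_intCast]
  simp only [integrandB_intCast]

theorem I_zpow_neg (m : ℤ) : Complex.I ^ (-m) = (-1) ^ m * Complex.I ^ m := by
  rw [zpow_neg, ← inv_zpow, Complex.inv_I, neg_eq_neg_one_mul, mul_zpow]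

theorem besselJ_neg_intCast {z : ℂ} (hz : z ≠ 0) (m : ℤ) :
    besselJ (-m) z = (-1) ^ m * besselJ m z := by
  have h := besselJ_intCast hz (-m)
  simp only [Int.cast_neg, neg_mul, Complex.cos_neg] at h
  rw [h, besselJ_intCast hz, I_zpow_neg]
  simp only [neg_mul]
  ring

theorem cos_intCast_mul_pi (m : ℤ) : Complex.cos (m * Real.pi) = (-1) ^ m := by
  have := Real.cos_int_mul_pi m
  have h : ((Real.cos (m * Real.pi) : ℝ) : ℂ) = (((-1) ^ m : ℝ) : ℂ) := by rw [this]
  push_cast at h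
  exact h

theorem sin_intCast_mul_pi (m : ℤ) : Complex.sin (m * Real.pi) = 0 :=
  Complex.sin_int_mul_pi m

theorem sin_mul_pi_ne_zero {μ : ℂ} (hμ : ∀ m : ℤ, μ ≠ m) : Complex.sin (μ * Real.pi) ≠ 0 := by
  rw [Complex.sin_ne_zero_iff]
  intro k hk
  exact hμ k (mul_right_cancel₀ (Complex.ofReal_ne_zero.2 Real.pi_ne_zero) hk)

theorem tendsto_sub_div_sin (m : ℤ) :
    Tendsto (fun μ : ℂ => (μ - m) / Complex.sin (μ * Real.pi)) (𝓝[≠] (m : ℂ))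
      (𝓝 ((-1) ^ m / Real.pi)) := by
  have h : HasDerivAt (fun μ : ℂ => Complex.sin (μ * Real.pi)) ((-1) ^ m * Real.pi) (m : ℂ) := by
    have := ((hasDerivAt_id (m : ℂ)).mul_const (Real.pi : ℂ)).csin
    rw [id, cos_intCast_mul_pi, one_mul] at this
    exact this
  have hpi : (Real.pi : ℂ) ≠ 0 := Complex.ofReal_ne_zero.2 Real.pi_ne_zero
  have h1 : ((-1 : ℂ)) ^ m ≠ 0 := zpow_ne_zero _ (by norm_num)
  have h2 := h.tendsto_slope.inv₀ (mul_ne_zero h1 hpi)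
  have h3 : ((-1 : ℂ) ^ m * Real.pi)⁻¹ = (-1) ^ m / Real.pi := by
    rw [mul_inv, ← inv_zpow]; norm_num; rfl
  rw [h3] at h2
  refine h2.congr fun μ => ?_
  rw [slope_def_field, sin_intCast_mul_pi, sub_zero, inv_div]

/-- The numerator is entire in `μ` and vanishes at `m` because `J_{-m} = (-1)^m J_m`, so the simple
zero of the sine is cancelled. Without this existence the `limUnder` defining `Y_m` would be a junk
value. -/
theorem exists_tendsto_neumannQuotient {z : ℂ} (hz : z ≠ 0) (m : ℤ) :
    ∃ L, Tendsto (fun μ => neumannQuotient μ z) (𝓝[≠] (m : ℂ)) (𝓝 L) := by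
  set N : ℂ → ℂ := fun μ => besselJ μ z * Complex.cos (μ * Real.pi) - besselJ (-μ) z with hN
  have hd : Differentiable ℂ N := by
    have h1 := differentiable_besselJ hz
    have h2 : Differentiable ℂ fun μ => besselJ (-μ) z := h1.comp differentiable_neg
    rw [hN]
    fun_prop
  have hN0 : N m = 0 := by
    simp only [hN]
    rw [cos_intCast_mul_pi, besselJ_neg_intCast hz]; ring
  have h := (hd m).hasDerivAt.tendsto_slope.mul (tendsto_sub_div_sin m)
  refine ⟨_, h.congr' ?_⟩
  filter_upwards [self_mem_nhdsWithin] with μ hμ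
  have : μ - m ≠ 0 := sub_ne_zero.2 hμ
  rw [slope_def_field, hN0, neumannQuotient]
  field_simp
  simp [hN]

theorem besselY_of_ne {μ : ℂ} (hμ : ∀ m : ℤ, μ ≠ m) (z : ℂ) :
    besselY μ z = neumannQuotient μ z := by
  rw [besselY, if_neg]
  rintro ⟨m, hm⟩
  exact hμ m hm

theorem eventually_norm_sub_lt (m : ℤ) {r : ℝ} (hr : 0 < r) :
    ∀ᶠ μ : ℂ in 𝓝[≠] (m : ℂ), ‖μ - m‖ < r :=
  mem_nhdsWithin_of_mem_nhds (by
    filter_upwards [Metric.ball_mem_nhds (m : ℂ) hr] with μ hμ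
    rwa [mem_ball_iff_norm] at hμ)

/-- Near an integer this excludes integral and half-integral orders together, so that both the
Neumann quotient and the generic branch of the gamma quotient apply. -/
theorem two_mul_ne_intCast {μ : ℂ} {m : ℤ} (h : ‖μ - m‖ < 1 / 4) (hne : μ ≠ m) (k : ℤ) :
    2 * μ ≠ k := by
  intro hk
  have h1 : ((k - 2 * m : ℤ) : ℂ) = 2 * (μ - m) := by push_cast; linear_combination -hk
  have h2 : ‖((k - 2 * m : ℤ) : ℂ)‖ < 1 := by
    rw [h1, norm_mul, Complex.norm_ofNat]; linarith
  rw [Complex.norm_intCast] at h2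
  have h3 : |k - 2 * m| < 1 := by exact_mod_cast h2
  have h4 : k - 2 * m = 0 := Int.abs_lt_one_iff.1 h3
  rw [h4, Int.cast_zero] at h1
  exact hne (sub_eq_zero.1 ((mul_eq_zero.1 h1.symm).resolve_left two_ne_zero))

theorem ne_intCast_of_two_mul {μ : ℂ} (h : ∀ k : ℤ, 2 * μ ≠ k) (m : ℤ) : μ ≠ m := fun hm =>
  h (2 * m) (by rw [hm]; push_cast; ring)

theorem nearestInt_of_norm_lt {μ : ℂ} {m : ℤ} (h : ‖μ - m‖ < 1 / 4) : nearestInt μ.re = m := by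
  have h1 := abs_lt.1 ((Complex.abs_re_le_norm _).trans_lt h)
  simp only [Complex.sub_re, Complex.intCast_re] at h1
  exact nearestInt_eq (by linarith [h1.1]) (by linarith [h1.2])

theorem tendsto_besselY {z : ℂ} (hz : z ≠ 0) (m : ℤ) :
    Tendsto (fun μ => besselY μ z) (𝓝[≠] (m : ℂ)) (𝓝 (besselY m z)) := by
  have h1 : besselY m z = limUnder (𝓝[≠] (m : ℂ)) fun ν => neumannQuotient ν z := by
    rw [besselY, if_pos ⟨m, rfl⟩]
  rw [h1]
  refine (tendsto_nhds_limUnder (exists_tendsto_neumannQuotient hz m)).congr' ?_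
  filter_upwards [eventually_norm_sub_lt m (r := 1 / 4) (by norm_num), self_mem_nhdsWithin]
    with μ hμ hne
  exact (besselY_of_ne (ne_intCast_of_two_mul (two_mul_ne_intCast hμ hne)) z).symm

theorem tendsto_hankel₁ {z : ℂ} (hz : z ≠ 0) (m : ℤ) :
    Tendsto (fun μ => hankel₁ μ z) (𝓝[≠] (m : ℂ)) (𝓝 (hankel₁ m z)) :=
  (((differentiable_besselJ hz).continuous.tendsto (m : ℂ)).mono_left nhdsWithin_le_nhds).add
    ((tendsto_besselY hz m).const_mul _)

theorem tendsto_hankel₂ {z : ℂ} (hz : z ≠ 0) (m : ℤ) :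
    Tendsto (fun μ => hankel₂ μ z) (𝓝[≠] (m : ℂ)) (𝓝 (hankel₂ m z)) :=
  (((differentiable_besselJ hz).continuous.tendsto (m : ℂ)).mono_left nhdsWithin_le_nhds).sub
    ((tendsto_besselY hz m).const_mul _)

/-! ### Non-integral order -/

theorem exp_I_mul_pi (μ : ℂ) : Complex.exp (Complex.I * μ * Real.pi) =
    Complex.cos (μ * Real.pi) + Complex.sin (μ * Real.pi) * Complex.I := by
  rw [← Complex.exp_mul_I]; congr 1; ring

theorem exp_neg_I_mul_pi (μ : ℂ) : Complex.exp (-Complex.I * μ * Real.pi) =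
    Complex.cos (μ * Real.pi) - Complex.sin (μ * Real.pi) * Complex.I := by
  have h := Complex.exp_mul_I (-(μ * Real.pi))
  rw [Complex.cos_neg, Complex.sin_neg] at h
  rw [show -Complex.I * μ * Real.pi = -(μ * Real.pi) * Complex.I by ring, h]; ring

theorem neg_I_mul_hankel₁ {μ : ℂ} (hμ : ∀ m : ℤ, μ ≠ m) (z : ℂ) :
    -Complex.I * hankel₁ μ z = (Complex.exp (-Complex.I * μ * Real.pi) * besselJ μ z -
      besselJ (-μ) z) / Complex.sin (μ * Real.pi) := by
  have hs := sin_mul_pi_ne_zero hμ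
  rw [hankel₁, besselY_of_ne hμ, neumannQuotient, exp_neg_I_mul_pi]
  generalize Complex.cos (μ * Real.pi) = c
  generalize Complex.sin (μ * Real.pi) = s at hs ⊢
  field_simp
  linear_combination -(besselJ μ z * c - besselJ (-μ) z) * Complex.I_sq

theorem I_mul_hankel₂ {μ : ℂ} (hμ : ∀ m : ℤ, μ ≠ m) (z : ℂ) :
    Complex.I * hankel₂ μ z = (Complex.exp (Complex.I * μ * Real.pi) * besselJ μ z -
      besselJ (-μ) z) / Complex.sin (μ * Real.pi) := by
  have hs := sin_mul_pi_ne_zero hμ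
  rw [hankel₂, besselY_of_ne hμ, neumannQuotient, exp_I_mul_pi]
  generalize Complex.cos (μ * Real.pi) = c
  generalize Complex.sin (μ * Real.pi) = s at hs ⊢
  field_simp
  linear_combination -(besselJ μ z * c - besselJ (-μ) z) * Complex.I_sq

theorem chi_of_re_gt {μ : ℂ} (h : -1 / 2 < μ.re) (z : ℂ) : chi μ z = 0 := by
  rw [chi, if_neg (not_le.2 h)]

/-- `χ` is nonzero only for real part at most `-1/2`, so at most one of the two terms survives, the
one selected by the sign of `Re μ`. For `Re μ = 0` the sign is `0` and all terms vanish. -/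
theorem mul_chi_sub_chi (T : ℂ) (μ z : ℂ) : T * chi μ z - chi (-μ) z =
    (if μ.re < 0 then T else -1) * chi (-μ * (Real.sign μ.re : ℝ)) z := by
  rcases lt_trichotomy μ.re 0 with h | h | h
  · rw [if_pos h, Real.sign_of_neg h, chi_of_re_gt (μ := -μ) (by simp; linarith)]
    simp
  · rw [if_neg (by simp [h]), h, Real.sign_zero, chi_of_re_gt (μ := μ) (by rw [h]; norm_num),
      chi_of_re_gt (μ := -μ) (by simp [h]; norm_num), chi_of_re_gt (by simp; norm_num)]
    simp
  · rw [if_neg (by linarith), Real.sign_of_pos h, chi_of_re_gt (μ := μ) (by linarith)]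
    simp

theorem neg_I_mul_hankel₁_eq_mixed₁ {z : ℂ} (hz : z ≠ 0) {μ : ℂ} (hμ : ∀ m : ℤ, μ ≠ m) :
    -Complex.I * hankel₁ μ z = mixed₁ μ z := by
  rw [neg_I_mul_hankel₁ hμ, besselJ_eq_B_add_chi hz, besselJ_eq_B_add_chi hz, mixed₁, calH₁,
    Tminus, ← mul_div_assoc, ← mul_chi_sub_chi]
  ring

theorem I_mul_hankel₂_eq_mixed₂ {z : ℂ} (hz : z ≠ 0) {μ : ℂ} (hμ : ∀ m : ℤ, μ ≠ m) :
    Complex.I * hankel₂ μ z = mixed₂ μ z := by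
  rw [I_mul_hankel₂ hμ, besselJ_eq_B_add_chi hz, besselJ_eq_B_add_chi hz, mixed₂, calH₂,
    Tplus, ← mul_div_assoc, ← mul_chi_sub_chi]
  ring

theorem tendsto_mixed₁ {z : ℂ} (hz : z ≠ 0) (m : ℤ) :
    Tendsto (fun μ => mixed₁ μ z) (𝓝[≠] (m : ℂ)) (𝓝 (-Complex.I * hankel₁ m z)) := by
  refine ((tendsto_hankel₁ hz m).const_mul _).congr' ?_
  filter_upwards [eventually_norm_sub_lt m (r := 1 / 4) (by norm_num), self_mem_nhdsWithin]
    with μ hμ hne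
  exact neg_I_mul_hankel₁_eq_mixed₁ hz (ne_intCast_of_two_mul (two_mul_ne_intCast hμ hne))

theorem tendsto_mixed₂ {z : ℂ} (hz : z ≠ 0) (m : ℤ) :
    Tendsto (fun μ => mixed₂ μ z) (𝓝[≠] (m : ℂ)) (𝓝 (Complex.I * hankel₂ m z)) := by
  refine ((tendsto_hankel₂ hz m).const_mul _).congr' ?_
  filter_upwards [eventually_norm_sub_lt m (r := 1 / 4) (by norm_num), self_mem_nhdsWithin]
    with μ hμ hne
  exact I_mul_hankel₂_eq_mixed₂ hz (ne_intCast_of_two_mul (two_mul_ne_intCast hμ hne))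

/-- Rounding is odd except at ties; a tie means `Re {μ} = 1/2`. This is what allows the integrals of
`B_μ` and `B_{-μ}` to be merged. -/
theorem fracPart_neg {μ : ℂ} (h : (fracPart μ).re < 1 / 2) : fracPart (-μ) = -fracPart μ := by
  have h1 := neg_half_lt_fracPart_re μ
  rw [fracPart_re] at h h1
  have h2 : nearestInt (-μ).re = -nearestInt μ.re :=
    nearestInt_eq (by push_cast; simp; linarith) (by push_cast; simp; linarith)
  rw [fracPart, h2, fracPart]
  push_cast; ring

theorem exp_neg_mul_I_cpow (μ : ℂ) :
    Complex.exp (-Complex.I * μ * Real.pi) * Complex.I ^ μ = Complex.I ^ (-μ) := by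
  rw [Complex.cpow_def_of_ne_zero Complex.I_ne_zero, Complex.cpow_def_of_ne_zero Complex.I_ne_zero,
    ← Complex.exp_add, Complex.log_I]
  congr 1; ring

theorem exp_neg_I_mul_pi_mul_exp (μ : ℂ) :
    Complex.exp (-Complex.I * μ * Real.pi) * Complex.exp (Complex.I * μ * Real.pi) = 1 := by
  rw [← Complex.exp_add, ← Complex.exp_zero]
  congr 1; ring

theorem B_neg {μ : ℂ} (h : (fracPart μ).re < 1 / 2) (z : ℂ) :
    B (-μ) z = Complex.I ^ (-μ) / Real.pi * ∫ θ in (0 : ℝ)..Real.pi,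
      Complex.exp (-Complex.I * z * Real.cos θ) * normGammaP (-fracPart μ) (logArg z θ) *
        Complex.cos (μ * θ) := by
  simp only [B, integrandB, fracPart_neg h, neg_mul, Complex.cos_neg]

theorem integral_combination {z : ℂ} (hz : z ≠ 0) {ν : ℂ} (h1 : -1 / 2 < ν.re)
    (h2 : ν.re < 1 / 2) (μ a b : ℂ) :
    ∫ θ in (0 : ℝ)..Real.pi, Complex.exp (-Complex.I * z * Real.cos θ) *
        (a * normGammaP ν (logArg z θ) - b * normGammaP (-ν) (logArg z θ)) * Complex.cos (μ * θ) =
      a * (∫ θ in (0 : ℝ)..Real.pi, Complex.exp (-Complex.I * z * Real.cos θ) *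
        normGammaP ν (logArg z θ) * Complex.cos (μ * θ)) -
      b * ∫ θ in (0 : ℝ)..Real.pi, Complex.exp (-Complex.I * z * Real.cos θ) *
        normGammaP (-ν) (logArg z θ) * Complex.cos (μ * θ) := by
  have i1 := intervalIntegrable_exp_mul_normGammaP_mul_cos hz h1 μ
  have i2 := intervalIntegrable_exp_mul_normGammaP_mul_cos hz (ν := -ν) (by simp; linarith) μ
  rw [← intervalIntegral.integral_const_mul, ← intervalIntegral.integral_const_mul,
    ← intervalIntegral.integral_sub (i1.const_mul a) (i2.const_mul b)]
  exact intervalIntegral.integral_congr fun θ _ => by ring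

theorem calH₁_eq {z : ℂ} (hz : z ≠ 0) {μ : ℂ} (h : (fracPart μ).re < 1 / 2) :
    calH₁ μ z = Complex.I ^ (-μ) / (Real.pi * Complex.sin (μ * Real.pi)) *
      ∫ θ in (0 : ℝ)..Real.pi, Complex.exp (-Complex.I * z * Real.cos θ) *
        (normGammaP (fracPart μ) (logArg z θ) - normGammaP (-fracPart μ) (logArg z θ)) *
        Complex.cos (μ * θ) := by
  have hc := integral_combination hz (neg_half_lt_fracPart_re μ) h μ 1 1
  simp only [one_mul] at hc
  rw [hc, calH₁, B_neg h, B, ← exp_neg_mul_I_cpow]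
  simp only [integrandB]
  ring

theorem calH₂_eq {z : ℂ} (hz : z ≠ 0) {μ : ℂ} (h : (fracPart μ).re < 1 / 2) :
    calH₂ μ z = Complex.I ^ μ / (Real.pi * Complex.sin (μ * Real.pi)) *
      ∫ θ in (0 : ℝ)..Real.pi, Complex.exp (-Complex.I * z * Real.cos θ) *
        (Complex.exp (Complex.I * μ * Real.pi) * normGammaP (fracPart μ) (logArg z θ) -
          Complex.exp (-Complex.I * μ * Real.pi) * normGammaP (-fracPart μ) (logArg z θ)) *
        Complex.cos (μ * θ) := by
  rw [integral_combination hz (neg_half_lt_fracPart_re μ) h μ, calH₂, B_neg h, B,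
    ← exp_neg_mul_I_cpow]
  simp only [integrandB]
  ring

/-! ### Limit of the integral term at integral order -/

theorem norm_cos_le_exp_norm (w : ℂ) : ‖Complex.cos w‖ ≤ Real.exp ‖w‖ := by
  have h1 := Complex.norm_exp_le_exp_norm (w * Complex.I)
  have h2 := Complex.norm_exp_le_exp_norm (-w * Complex.I)
  rw [norm_mul, Complex.norm_I, mul_one] at h1 h2
  rw [norm_neg] at h2
  rw [Complex.cos, norm_div, Complex.norm_ofNat]
  have h3 := norm_add_le (Complex.exp (w * Complex.I)) (Complex.exp (-w * Complex.I))
  linarith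

/-- The integrand without the cosine is analytic in `ν` and bounded by `M` on `‖ν‖ ≤ 1/4`, where `M`
is integrable in `θ` since `-1/4 > -1/2`. Cauchy's estimate on circles of radius `1/8` bounds its
`ν`-derivative by `8M` for `‖ν‖ < 1/8`; the mean value inequality between `±ε` then gives `16 M
‖ε‖`, and the derivative at `0` controls `Γ(0, ·)`. -/
theorem exists_bound_normGammaP_sub {z : ℂ} (hz : z ≠ 0) : ∃ g : ℝ → ℝ,
    IntervalIntegrable g volume 0 Real.pi ∧ ∀ θ ∈ Set.Ioo 0 Real.pi,
      0 ≤ g θ ∧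
      (∀ ε : ℂ, ‖ε‖ < 1 / 8 → ‖Complex.exp (-Complex.I * z * Real.cos θ) *
        (normGammaP ε (logArg z θ) - normGammaP (-ε) (logArg z θ))‖ ≤ ‖ε‖ * g θ) ∧
      ‖Complex.exp (-Complex.I * z * Real.cos θ) * upperGamma 0 (logArg z θ)‖ ≤ g θ := by
  obtain ⟨C, hC0, hC⟩ := exists_norm_exp_mul_normGammaP_le hz (1 / 4)
  have i1 := intervalIntegrable_exp_mul_log_one_add_cos (c := 1 / 4) (by norm_num)
  have i2 := intervalIntegrable_exp_mul_log_one_add_cos (c := -1 / 4) (by norm_num)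
  refine ⟨_, (i1.add i2).const_mul (16 * C), fun θ hθ => ?_⟩
  set x := Real.log (1 + Real.cos θ) with hx
  set M := C * (Real.exp (1 / 4 * x) + Real.exp (-1 / 4 * x)) with hM
  have hM0 : 0 ≤ M := by positivity
  set f : ℂ → ℂ := fun ν => Complex.exp (-Complex.I * z * Real.cos θ) * normGammaP ν (logArg z θ)
    with hf
  have hre (ν : ℂ) (hν : ‖ν‖ ≤ 1 / 4) : -1 / 4 ≤ ν.re ∧ ν.re ≤ 1 / 4 := by
    have h1 := abs_le.1 ((Complex.abs_re_le_norm ν).trans hν)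
    exact ⟨by linarith [h1.1], h1.2⟩
  have hfM (ν : ℂ) (hν : ‖ν‖ ≤ 1 / 4) : ‖f ν‖ ≤ M := by
    obtain ⟨h1, h2⟩ := hre ν hν
    refine (hC ν hν (by linarith) θ (Ioo_zero_pi_subset hθ)).trans
      (mul_le_mul_of_nonneg_left ?_ hC0)
    rcases le_total 0 x with h0 | h0
    · exact (Real.exp_le_exp.2 (by nlinarith)).trans (le_add_of_nonneg_right (Real.exp_pos _).le)
    · exact (Real.exp_le_exp.2 (by nlinarith)).trans (le_add_of_nonneg_left (Real.exp_pos _).le)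
  have hfd : DifferentiableOn ℂ f {ν | -1 < ν.re} := fun ν hν =>
    ((differentiableAt_normGammaP_left hν _).const_mul _).differentiableWithinAt
  have hderiv (ν : ℂ) (hν : ‖ν‖ < 1 / 8) : ‖deriv f ν‖ ≤ 8 * M := by
    have hball (w : ℂ) (hw : w ∈ Metric.closedBall ν (1 / 8)) : ‖w‖ ≤ 1 / 4 := by
      have h1 := mem_closedBall_iff_norm.1 hw
      have h2 := norm_add_le (w - ν) ν
      rw [sub_add_cancel] at h2
      linarith
    refine (Complex.norm_deriv_le_of_forall_mem_sphere_norm_le (R := 1 / 8) (C := M) (by norm_num)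
      (hfd.diffContOnCl_ball fun w hw => ?_) fun w hw => hfM w (hball w
        (Metric.sphere_subset_closedBall hw))).trans (le_of_eq (by ring))
    have := (hre w (hball w hw)).1
    change -1 < w.re
    linarith
  refine ⟨by positivity, fun ε hε => ?_, ?_⟩
  · have hmem (ν : ℂ) (hν : ‖ν‖ < 1 / 8) : ν ∈ Metric.ball (0 : ℂ) (1 / 8) :=
      mem_ball_zero_iff.2 hν
    have h := Convex.norm_image_sub_le_of_norm_deriv_le (𝕜 := ℂ) (f := f)
      (s := Metric.ball (0 : ℂ) (1 / 8)) (x := -ε) (y := ε) (C := 8 * M)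
      (fun ν hν => by
        have h1 := mem_ball_zero_iff.1 hν
        have h2 := (hre ν (by linarith)).1
        exact (differentiableAt_normGammaP_left (by linarith) _).const_mul _)
      (fun ν hν => hderiv ν (mem_ball_zero_iff.1 hν)) (convex_ball _ _)
      (hmem _ (by rwa [norm_neg])) (hmem _ hε)
    rw [mul_sub]
    refine h.trans (le_of_eq ?_)
    rw [sub_neg_eq_add, ← two_mul, norm_mul, Complex.norm_ofNat, hM]
    ring
  · have h := hderiv 0 (by simp)
    have h1 : deriv f 0 = Complex.exp (-Complex.I * z * Real.cos θ) * -upperGamma 0 (logArg z θ) :=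
      ((hasDerivAt_normGammaP_left_zero _).const_mul _).deriv
    rw [h1, mul_neg, norm_neg] at h
    refine h.trans ?_
    rw [hM]
    nlinarith

theorem measurable_exp_mul_upperGamma (z : ℂ) : Measurable fun θ : ℝ =>
    Complex.exp (-Complex.I * z * Real.cos θ) * upperGamma 0 (logArg z θ) := by
  have := continuous_upperGamma_zero.measurable.comp (measurable_logArg z)
  simp only [Function.comp_def] at this
  fun_prop

theorem intervalIntegrable_exp_mul_upperGamma {z : ℂ} (hz : z ≠ 0) (m : ℤ) :
    IntervalIntegrable (fun θ : ℝ => Complex.exp (-Complex.I * z * Real.cos θ) *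
      upperGamma 0 (logArg z θ) * Complex.cos (m * θ)) volume 0 Real.pi := by
  obtain ⟨g, hg, hb⟩ := exists_bound_normGammaP_sub hz
  refine IntervalIntegrable.mul_continuousOn ?_ (by fun_prop)
  refine hg.mono_fun' (measurable_exp_mul_upperGamma z).aestronglyMeasurable ?_
  exact (ae_restrict_iff' measurableSet_uIoc).2 (ae_uIoc_mem_Ioo fun θ hθ => (hb θ hθ).2.2)

theorem tendsto_calH₁ {z : ℂ} (hz : z ≠ 0) (m : ℤ) :
    Tendsto (fun μ => calH₁ μ z) (𝓝[≠] (m : ℂ)) (𝓝 (Complex.I ^ (-m) / Real.pi *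
      ((-1) ^ m / Real.pi) * (-2 * ∫ θ in (0 : ℝ)..Real.pi,
        Complex.exp (-Complex.I * z * Real.cos θ) * upperGamma 0 (logArg z θ) *
          Complex.cos (m * θ)))) := by
  obtain ⟨g, hg, hb⟩ := exists_bound_normGammaP_sub hz
  have hI : Tendsto (fun μ : ℂ => Complex.I ^ (-μ) / Real.pi) (𝓝[≠] (m : ℂ))
      (𝓝 (Complex.I ^ (-m) / Real.pi)) := by
    have h : Continuous fun μ : ℂ => Complex.I ^ (-μ) / (Real.pi : ℂ) :=
      (continuous_neg.const_cpow (Or.inl Complex.I_ne_zero)).div_const _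
    have h1 := (h.tendsto (m : ℂ)).mono_left (nhdsWithin_le_nhds (s := {(m : ℂ)}ᶜ))
    rwa [← Int.cast_neg, Complex.cpow_intCast] at h1
  -- The factor `1/(μ - m)` is moved under the integral and later compensated by `(μ - m)/sin μπ`;
  -- pointwise, the quotient is a slope of `μ ↦ P(μ-m) - P(-(μ-m))` at `m`.
  have hint : Tendsto (fun μ : ℂ => ∫ θ in (0 : ℝ)..Real.pi,
      Complex.exp (-Complex.I * z * Real.cos θ) *
        ((normGammaP (μ - m) (logArg z θ) - normGammaP (-(μ - m)) (logArg z θ))) / (μ - m) *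
        Complex.cos (μ * θ)) (𝓝[≠] (m : ℂ)) (𝓝 (∫ θ in (0 : ℝ)..Real.pi,
          Complex.exp (-Complex.I * z * Real.cos θ) * (-2 * upperGamma 0 (logArg z θ)) *
            Complex.cos (m * θ))) := by
    refine intervalIntegral.tendsto_integral_filter_of_dominated_convergence
      (fun θ => g θ * Real.exp ((‖(m : ℂ)‖ + 1) * Real.pi)) ?_ ?_ (hg.mul_const _)
      (ae_uIoc_mem_Ioo fun θ hθ => ?_)
    · filter_upwards [eventually_norm_sub_lt m (r := 1 / 8) (by norm_num)] with μ hμ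
      have h1 := abs_lt.1 ((Complex.abs_re_le_norm _).trans_lt hμ)
      have m1 := measurable_exp_mul_normGammaP z (ν := μ - m) (by linarith [h1.1])
      have m2 := measurable_exp_mul_normGammaP z (ν := -(μ - m))
        (by rw [Complex.neg_re]; linarith [h1.2])
      simp only [mul_sub]
      exact (((m1.sub m2).div_const _).mul (by fun_prop)).aestronglyMeasurable
    · filter_upwards [eventually_norm_sub_lt m (r := 1 / 8) (by norm_num), self_mem_nhdsWithin]
        with μ hμ hne
      refine ae_uIoc_mem_Ioo fun θ hθ => ?_
      obtain ⟨hg0, h1, -⟩ := hb θ hθ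
      have hpos : 0 < ‖μ - m‖ := norm_pos_iff.2 (sub_ne_zero.2 hne)
      have h2 : ‖Complex.cos (μ * θ)‖ ≤ Real.exp ((‖(m : ℂ)‖ + 1) * Real.pi) := by
        refine (norm_cos_le_exp_norm _).trans (Real.exp_le_exp.2 ?_)
        rw [norm_mul, Complex.norm_real, Real.norm_of_nonneg hθ.1.le]
        have h3 := norm_add_le (μ - m) (m : ℂ)
        rw [sub_add_cancel] at h3
        exact mul_le_mul (by linarith) hθ.2.le hθ.1.le (by positivity)
      rw [norm_mul, norm_div]
      have h4 : ‖Complex.exp (-Complex.I * z * Real.cos θ) * (normGammaP (μ - m) (logArg z θ) -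
          normGammaP (-(μ - m)) (logArg z θ))‖ / ‖μ - m‖ ≤ g θ := by
        rw [div_le_iff₀ hpos, mul_comm (g θ)]
        exact h1 _ hμ
      exact mul_le_mul h4 h2 (norm_nonneg _) hg0
    · refine Tendsto.mul ?_ ?_
      · have hd := hasDerivAt_normGammaP_left_zero (logArg z θ)
        have hd2 : HasDerivAt (fun μ : ℂ => Complex.exp (-Complex.I * z * Real.cos θ) *
            (normGammaP (μ - m) (logArg z θ) - normGammaP (-(μ - m)) (logArg z θ)))
            (Complex.exp (-Complex.I * z * Real.cos θ) * (-2 * upperGamma 0 (logArg z θ)))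
            (m : ℂ) := by
          have h1 : HasDerivAt (fun μ : ℂ => μ - m) 1 (m : ℂ) := (hasDerivAt_id _).sub_const _
          have h2 := HasDerivAt.comp_of_eq (m : ℂ) hd h1 (sub_self _).symm
          have h3 := HasDerivAt.comp_of_eq (m : ℂ) hd h1.neg (by simp)
          refine ((h2.sub h3).const_mul _).congr_deriv ?_
          ring
        refine hd2.tendsto_slope.congr fun μ => ?_
        rw [slope_def_field]
        simp
      · have : Continuous fun μ : ℂ => Complex.cos (μ * θ) := by fun_prop
        exact (this.tendsto _).mono_left nhdsWithin_le_nhds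
  have hval : ∫ θ in (0 : ℝ)..Real.pi, Complex.exp (-Complex.I * z * Real.cos θ) *
      (-2 * upperGamma 0 (logArg z θ)) * Complex.cos (m * θ) =
      -2 * ∫ θ in (0 : ℝ)..Real.pi, Complex.exp (-Complex.I * z * Real.cos θ) *
        upperGamma 0 (logArg z θ) * Complex.cos (m * θ) := by
    rw [← intervalIntegral.integral_const_mul]
    exact intervalIntegral.integral_congr fun θ _ => by ring
  rw [hval] at hint
  refine ((hI.mul (tendsto_sub_div_sin m)).mul hint).congr' ?_
  filter_upwards [eventually_norm_sub_lt m (r := 1 / 4) (by norm_num), self_mem_nhdsWithin]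
    with μ hμ hne
  have hfr : fracPart μ = μ - m := by rw [fracPart, nearestInt_of_norm_lt hμ]
  have hre : (fracPart μ).re < 1 / 2 := by
    rw [hfr]; linarith [Complex.re_le_norm (μ - m)]
  have hne0 : μ - m ≠ 0 := sub_ne_zero.2 hne
  have hsplit : ∫ θ in (0 : ℝ)..Real.pi, Complex.exp (-Complex.I * z * Real.cos θ) *
        ((normGammaP (μ - m) (logArg z θ) - normGammaP (-(μ - m)) (logArg z θ))) / (μ - m) *
        Complex.cos (μ * θ) = (μ - m)⁻¹ * ∫ θ in (0 : ℝ)..Real.pi,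
      Complex.exp (-Complex.I * z * Real.cos θ) *
        ((normGammaP (μ - m) (logArg z θ) - normGammaP (-(μ - m)) (logArg z θ))) *
        Complex.cos (μ * θ) := by
    rw [← intervalIntegral.integral_const_mul]
    exact intervalIntegral.integral_congr fun θ _ => by ring
  rw [calH₁_eq hz hre, hfr, hsplit]
  field_simp

/-! ### Limit of the correction at integral order -/

theorem sigma_neg (m : ℤ) (z : ℂ) : sigma (-m) z = sigma m z := by
  rw [sigma, sigma, Int.natAbs_neg, zpow_neg, ← inv_zpow]
  norm_num

theorem exp_log_two_add_logNegI {z : ℂ} (hz : z ≠ 0) (k : ℕ) :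
    Complex.exp (-(k : ℂ) * ((Real.log 2 : ℝ) + logNegI z)) =
      (-1) ^ k * (2 * Complex.I * z) ^ (-(k : ℤ)) := by
  have h : Complex.exp ((Real.log 2 : ℝ) + logNegI z) = -1 * (2 * Complex.I * z) := by
    rw [Complex.exp_add, exp_logNegI hz, ← Complex.ofReal_exp, Real.exp_log (by norm_num)]
    push_cast; ring
  rw [neg_mul, Complex.exp_neg, Complex.exp_nat_mul, h, zpow_neg, zpow_natCast, mul_pow, mul_inv,
    ← inv_pow]
  norm_num

/-- Euler's reflection formula at `j - 2μ`, where `sin π(j - 2μ)` contains the factor `sin μπ`. The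
right-hand side has no singularity at an integer `μ ≥ j`, so the limit can be read off. -/
theorem inv_Gamma_sub_two_mul {μ : ℂ} (hμ : ∀ k : ℤ, 2 * μ ≠ k) (j : ℕ) :
    (Complex.Gamma (j - 2 * μ))⁻¹ / Complex.sin (μ * Real.pi) =
      (-1) ^ (j + 1) * (2 * Complex.cos (μ * Real.pi) * Complex.Gamma (1 - j + 2 * μ)) /
        Real.pi := by
  have h := Complex.Gamma_mul_Gamma_one_sub (j - 2 * μ)
  have hs := sin_mul_pi_ne_zero (ne_intCast_of_two_mul hμ)
  have hpi : (Real.pi : ℂ) ≠ 0 := Complex.ofReal_ne_zero.2 Real.pi_ne_zero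
  have hsin : Complex.sin (Real.pi * (j - 2 * μ)) =
      (-1) ^ (j + 1) * (2 * Complex.sin (μ * Real.pi) * Complex.cos (μ * Real.pi)) := by
    rw [show (Real.pi : ℂ) * (j - 2 * μ) = (j : ℤ) * Real.pi - 2 * (μ * Real.pi) by
      push_cast; ring, Complex.sin_sub, sin_intCast_mul_pi, cos_intCast_mul_pi,
      Complex.sin_two_mul, zpow_natCast, pow_succ]
    ring
  have hsin0 : Complex.sin (Real.pi * (j - 2 * μ)) ≠ 0 := by
    rw [mul_comm]
    refine sin_mul_pi_ne_zero fun k hk => hμ (j - k) ?_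
    push_cast; linear_combination -hk
  have hG : Complex.Gamma (j - 2 * μ) ≠ 0 := by
    intro h0
    rw [h0, zero_mul] at h
    exact div_ne_zero hpi hsin0 h.symm
  rw [show 1 - ((j : ℂ) - 2 * μ) = 1 - j + 2 * μ by ring, eq_div_iff hsin0, hsin] at h
  generalize Complex.Gamma (j - 2 * μ) = g at h hG ⊢
  generalize Complex.Gamma (1 - j + 2 * μ) = g' at h ⊢
  generalize Complex.sin (μ * Real.pi) = s at h hs ⊢
  field_simp
  linear_combination -h

theorem tendsto_chi_div_sin {z : ℂ} (hz : z ≠ 0) (N : ℕ) (hN : 1 ≤ N) :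
    Tendsto (fun μ => chi (-μ) z / Complex.sin (μ * Real.pi)) (𝓝[≠] ((N : ℤ) : ℂ))
      (𝓝 (Complex.I ^ (-(N : ℤ)) * (2 / Real.pi) * (-1) ^ N * sigma N z)) := by
  have hlim (j : ℕ) (hj : j ∈ Finset.Icc 1 N) : Tendsto (fun μ : ℂ => Complex.Gamma (j - μ - 1 / 2) *
      ((-1) ^ (j + 1) * (2 * Complex.cos (μ * Real.pi) * Complex.Gamma (1 - j + 2 * μ)) /
        Real.pi) / Complex.Gamma j * Complex.exp ((j - μ - 1) * ((Real.log 2 : ℝ) + logNegI z)))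
      (𝓝[≠] ((N : ℤ) : ℂ)) (𝓝 (Complex.Gamma (j - (N : ℤ) - 1 / 2) *
      ((-1) ^ (j + 1) * (2 * Complex.cos (((N : ℤ) : ℂ) * Real.pi) *
        Complex.Gamma (1 - j + 2 * (N : ℤ))) / Real.pi) / Complex.Gamma j *
          Complex.exp ((j - (N : ℤ) - 1) * ((Real.log 2 : ℝ) + logNegI z)))) := by
    have hj' := Finset.mem_Icc.1 hj
    -- At `μ = N` this gamma function has a half-integral argument; the next one has the positive
    -- argument `1 - j + 2N`.
    have hc1 : ContinuousAt (fun μ : ℂ => Complex.Gamma (j - μ - 1 / 2)) ((N : ℤ) : ℂ) := by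
      refine ContinuousAt.comp (g := Complex.Gamma) (Complex.continuousAt_Gamma _ fun k hk => ?_)
        (by fun_prop)
      have h1 : ((2 * j + 2 * k : ℤ) : ℂ) = ((2 * N + 1 : ℤ) : ℂ) := by
        push_cast at hk ⊢; linear_combination 2 * hk
      have h2 := Int.cast_injective h1
      omega
    have hc2 : ContinuousAt (fun μ : ℂ => Complex.Gamma (1 - j + 2 * μ)) ((N : ℤ) : ℂ) := by
      refine ContinuousAt.comp (g := Complex.Gamma) (Complex.continuousAt_Gamma _ fun k hk => ?_)
        (by fun_prop)
      have h1 : ((1 - j + 2 * N : ℤ) : ℂ) = ((-k : ℤ) : ℂ) := by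
        push_cast at hk ⊢; exact hk
      have h2 := Int.cast_injective h1
      omega
    refine (ContinuousAt.tendsto ?_).mono_left nhdsWithin_le_nhds
    fun_prop
  have hsum := tendsto_finsetSum (Finset.Icc 1 N) hlim
  have hpre : Tendsto (fun μ : ℂ => Complex.I ^ (-μ) / (Real.sqrt Real.pi : ℝ) *
      Complex.exp (Complex.I * z)) (𝓝[≠] ((N : ℤ) : ℂ))
      (𝓝 (Complex.I ^ (-(N : ℤ)) / (Real.sqrt Real.pi : ℝ) * Complex.exp (Complex.I * z))) := by
    have h : Continuous fun μ : ℂ => Complex.I ^ (-μ) / ((Real.sqrt Real.pi : ℝ) : ℂ) *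
        Complex.exp (Complex.I * z) :=
      ((continuous_neg.const_cpow (Or.inl Complex.I_ne_zero)).div_const _).mul_const _
    have h1 := (h.tendsto ((N : ℤ) : ℂ)).mono_left (nhdsWithin_le_nhds (s := {((N : ℤ) : ℂ)}ᶜ))
    rwa [← Int.cast_neg, Complex.cpow_intCast] at h1
  have hval : Complex.I ^ (-(N : ℤ)) / (Real.sqrt Real.pi : ℝ) * Complex.exp (Complex.I * z) *
      ∑ j ∈ Finset.Icc 1 N, Complex.Gamma (j - (N : ℤ) - 1 / 2) *
      ((-1) ^ (j + 1) * (2 * Complex.cos (((N : ℤ) : ℂ) * Real.pi) *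
        Complex.Gamma (1 - j + 2 * (N : ℤ))) / Real.pi) / Complex.Gamma j *
          Complex.exp ((j - (N : ℤ) - 1) * ((Real.log 2 : ℝ) + logNegI z)) =
      Complex.I ^ (-(N : ℤ)) * (2 / Real.pi) * (-1) ^ N * sigma N z := by
    have hre : ∑ j ∈ Finset.Icc 1 N, Complex.Gamma (j - (N : ℤ) - 1 / 2) *
      ((-1) ^ (j + 1) * (2 * Complex.cos (((N : ℤ) : ℂ) * Real.pi) *
        Complex.Gamma (1 - j + 2 * (N : ℤ))) / Real.pi) / Complex.Gamma j *
          Complex.exp ((j - (N : ℤ) - 1) * ((Real.log 2 : ℝ) + logNegI z)) =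
        2 / Real.pi * ∑ k ∈ Finset.Icc 1 N, Complex.Gamma (1 / 2 - k) * Complex.Gamma (k + N) /
          Complex.Gamma (N - k + 1) * (2 * Complex.I * z) ^ (-(k : ℤ)) := by
      rw [Finset.mul_sum]
      -- The exponent `j - N - 1` of `-2iz` becomes `-k` for `k = N + 1 - j`, matching the powers in
      -- `sigma`.
      refine Finset.sum_nbij' (fun j => N + 1 - j) (fun k => N + 1 - k) ?_ ?_ ?_ ?_ ?_
      · intro j hj; have := Finset.mem_Icc.1 hj; exact Finset.mem_Icc.2 (by omega)
      · intro j hj; have := Finset.mem_Icc.1 hj; exact Finset.mem_Icc.2 (by omega)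
      · intro j hj; have := Finset.mem_Icc.1 hj; omega
      · intro j hj; have := Finset.mem_Icc.1 hj; omega
      · intro j hj
        have hj' := Finset.mem_Icc.1 hj
        obtain ⟨k, hk⟩ : ∃ k, j + k = N + 1 := ⟨N + 1 - j, by omega⟩
        have hkj : N + 1 - j = k := by omega
        have hj2 : (j : ℂ) = N + 1 - k := by
          have : ((j + k : ℕ) : ℂ) = ((N + 1 : ℕ) : ℂ) := by rw [hk]
          push_cast at this; linear_combination this
        have hsign : (-1 : ℂ) ^ (j + 1) * (-1) ^ N * (-1) ^ k = 1 := by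
          rw [← pow_add, ← pow_add, show j + 1 + N + k = 2 * (N + 1) by omega, pow_mul]
          norm_num
        rw [hkj, cos_intCast_mul_pi, zpow_natCast, Int.cast_natCast, hj2,
          show (N : ℂ) + 1 - k - N - 1 / 2 = 1 / 2 - k by ring,
          show 1 - ((N : ℂ) + 1 - k) + 2 * N = k + N by ring,
          show (N : ℂ) + 1 - k = N - k + 1 by ring,
          show (N : ℂ) - k + 1 - N - 1 = -k by ring, exp_log_two_add_logNegI hz]
        linear_combination (Complex.Gamma (1 / 2 - k) * 2 * Complex.Gamma (k + N) / Real.pi /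
          Complex.Gamma (N - k + 1) * (2 * Complex.I * z) ^ (-(k : ℤ))) * hsign
    have hsign : (-1 : ℂ) ^ N * (-1) ^ N = 1 := by
      rw [← pow_add, ← two_mul, pow_mul]; norm_num
    rw [hre, sigma, Int.natAbs_natCast, zpow_natCast]
    generalize ∑ k ∈ Finset.Icc 1 N, Complex.Gamma (1 / 2 - k) * Complex.Gamma (k + N) /
          Complex.Gamma (N - k + 1) * (2 * Complex.I * z) ^ (-(k : ℤ)) = S
    linear_combination -(Complex.I ^ (-(N : ℤ)) * (2 / Real.pi) / (Real.sqrt Real.pi : ℝ) *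
      Complex.exp (Complex.I * z) * S) * hsign
  rw [← hval]
  refine (hpre.mul hsum).congr' ?_
  filter_upwards [eventually_norm_sub_lt (N : ℤ) (r := 1 / 4) (by norm_num), self_mem_nhdsWithin]
    with μ hμ hne
  have h2 := two_mul_ne_intCast hμ hne
  have hμ' : ‖-μ - ((-(N : ℤ) : ℤ) : ℂ)‖ < 1 / 4 := by
    rw [Int.cast_neg, show -μ - -((N : ℤ) : ℂ) = -(μ - (N : ℤ)) by ring, norm_neg]; exact hμ
  have hnear := nearestInt_of_norm_lt hμ'
  have hN1 : (1 : ℝ) ≤ N := by exact_mod_cast hN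
  have hre : (-μ).re ≤ -1 / 2 := by
    have h1 := abs_lt.1 ((Complex.abs_re_le_norm _).trans_lt hμ)
    simp at h1 ⊢
    linarith [h1.1]
  have hex : ¬ ∃ m : ℤ, m ≤ -1 ∧ -μ = m + 1 / 2 := by
    rintro ⟨m, -, hm⟩
    refine h2 (-(2 * m + 1)) ?_
    push_cast; linear_combination -2 * hm
  rw [chi, if_pos hre, hnear, neg_neg, Int.toNat_natCast, mul_div_assoc, Finset.sum_div]
  congr 1
  refine Finset.sum_congr rfl fun j _ => ?_
  rw [gammaQuotient, if_neg hex, ← inv_Gamma_sub_two_mul h2,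
    show (j : ℂ) + -μ - 1 / 2 = j - μ - 1 / 2 by ring, show (j : ℂ) + 2 * -μ = j - 2 * μ by ring,
    show (j : ℂ) + -μ - 1 = j - μ - 1 by ring]
  ring

theorem tendsto_chi_term {z : ℂ} (hz : z ≠ 0) (N : ℕ) :
    Tendsto (fun μ => Tminus μ * (chi (-μ * (Real.sign μ.re : ℝ)) z / Complex.sin (μ * Real.pi)))
      (𝓝[≠] ((N : ℤ) : ℂ)) (𝓝 (-(Complex.I ^ (-(N : ℤ)) * (2 / Real.pi) * (-1) ^ N * sigma N z))) := by
  rcases Nat.eq_zero_or_pos N with rfl | hN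
  · have h0 : sigma ((0 : ℕ) : ℤ) z = 0 := by simp [sigma]
    rw [h0, mul_zero, neg_zero]
    refine tendsto_const_nhds.congr' ?_
    filter_upwards [eventually_norm_sub_lt ((0 : ℕ) : ℤ) (r := 1 / 4) (by norm_num)] with μ hμ
    have h1 := abs_lt.1 ((Complex.abs_re_le_norm _).trans_lt hμ)
    simp only [Nat.cast_zero, Int.cast_zero, sub_zero] at h1
    rw [chi_of_re_gt, zero_div, mul_zero]
    rw [Complex.re_mul_ofReal, Complex.neg_re]
    rcases Real.sign_apply_eq μ.re with h | h | h <;> rw [h] <;> linarith [h1.1, h1.2]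
  · refine (tendsto_chi_div_sin hz N hN).neg.congr' ?_
    filter_upwards [eventually_norm_sub_lt (N : ℤ) (r := 1 / 4) (by norm_num)] with μ hμ
    have h1 := abs_lt.1 ((Complex.abs_re_le_norm _).trans_lt hμ)
    have hN1 : (1 : ℝ) ≤ N := by exact_mod_cast hN
    simp only [Complex.sub_re, Int.cast_natCast, Complex.natCast_re] at h1
    have hpos : 0 < μ.re := by linarith [h1.1]
    rw [Tminus, if_neg (not_lt.2 hpos.le), Real.sign_of_pos hpos]
    simp

/-! ### The formulas at integral order -/

theorem hankel₁_natCast {z : ℂ} (hz : z ≠ 0) (N : ℕ) : hankel₁ ((N : ℤ) : ℂ) z =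
    2 * Complex.I ^ ((N : ℤ) - 1) / Real.pi *
      (1 / Real.pi * (∫ θ in (0 : ℝ)..Real.pi, Complex.exp (-Complex.I * z * Real.cos θ) *
        upperGamma 0 (logArg z θ) * Complex.cos (((N : ℤ) : ℂ) * θ)) + sigma N z) := by
  -- The same expression `mixed₁` has two limits: the Hankel function by continuity in the order,
  -- and the explicit value by the termwise computation.
  have h := tendsto_nhds_unique (tendsto_mixed₁ hz N)
    ((tendsto_calH₁ hz N).add (tendsto_chi_term hz N))
  have hI : Complex.I ^ (-(N : ℤ)) * (-1) ^ N = Complex.I ^ (N : ℤ) := by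
    rw [I_zpow_neg, zpow_natCast, mul_right_comm, ← mul_pow]; norm_num
  have hI2 : Complex.I ^ ((N : ℤ) - 1) = -Complex.I * Complex.I ^ (N : ℤ) := by
    rw [zpow_sub_one₀ Complex.I_ne_zero, Complex.inv_I]; ring
  rw [zpow_natCast] at h
  rw [hI2]
  generalize (∫ θ in (0 : ℝ)..Real.pi, Complex.exp (-Complex.I * z * Real.cos θ) *
        upperGamma 0 (logArg z θ) * Complex.cos (((N : ℤ) : ℂ) * θ)) = Q at h ⊢
  rw [← hI]
  linear_combination Complex.I * h + hankel₁ ((N : ℤ) : ℂ) z * Complex.I_sq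

/-- The limit of `H_{-μ} = e^{iμπ} H_μ` as `μ → m`, which reduces integral orders to nonnegative
ones. -/
theorem hankel₁_neg_intCast {z : ℂ} (hz : z ≠ 0) (m : ℤ) :
    hankel₁ (-m) z = (-1) ^ m * hankel₁ m z := by
  have hneg : Tendsto (fun μ : ℂ => -μ) (𝓝[≠] (m : ℂ)) (𝓝[≠] ((-m : ℤ) : ℂ)) := by
    refine tendsto_nhdsWithin_iff.2 ⟨?_, ?_⟩
    · rw [Int.cast_neg]
      exact (continuous_neg.tendsto (m : ℂ)).mono_left nhdsWithin_le_nhds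
    · filter_upwards [self_mem_nhdsWithin] with μ hμ h
      refine hμ (neg_injective ?_)
      simpa using h
  have h1 := (tendsto_hankel₁ hz (-m)).comp hneg
  have hexp : Tendsto (fun μ : ℂ => Complex.exp (Complex.I * μ * Real.pi)) (𝓝[≠] (m : ℂ))
      (𝓝 ((-1) ^ m)) := by
    have h : Continuous fun μ : ℂ => Complex.exp (Complex.I * μ * Real.pi) := by fun_prop
    have h2 := (h.tendsto (m : ℂ)).mono_left (nhdsWithin_le_nhds (s := {(m : ℂ)}ᶜ))
    rwa [exp_I_mul_pi, cos_intCast_mul_pi, sin_intCast_mul_pi, zero_mul, add_zero] at h2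
  have h2 := hexp.mul (tendsto_hankel₁ hz m)
  rw [← Int.cast_neg]
  refine tendsto_nhds_unique h1 (h2.congr' ?_)
  filter_upwards [eventually_norm_sub_lt m (r := 1 / 4) (by norm_num), self_mem_nhdsWithin]
    with μ hμ hne
  have hni := ne_intCast_of_two_mul (two_mul_ne_intCast hμ hne)
  have hni' (k : ℤ) : -μ ≠ k := fun hk => hni (-k) (by push_cast; rw [← hk, neg_neg])
  have e1 := neg_I_mul_hankel₁ hni z
  have e2 := neg_I_mul_hankel₁ hni' z
  have hs := sin_mul_pi_ne_zero hni
  rw [neg_neg, neg_mul μ, Complex.sin_neg,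
    show -Complex.I * -μ * Real.pi = Complex.I * μ * Real.pi by ring] at e2
  refine mul_left_cancel₀ (neg_ne_zero.2 Complex.I_ne_zero) ?_
  rw [Function.comp_apply, e2, mul_left_comm, e1]
  have h3 := exp_neg_I_mul_pi_mul_exp μ
  generalize Complex.exp (Complex.I * μ * Real.pi) = e at h3 ⊢
  generalize Complex.exp (-Complex.I * μ * Real.pi) = e' at h3 ⊢
  field_simp
  linear_combination besselJ μ z * h3

theorem hankel₁_intCast {z : ℂ} (hz : z ≠ 0) (m : ℤ) : hankel₁ m z =
    2 * Complex.I ^ (m - 1) / Real.pi *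
      (1 / Real.pi * (∫ θ in (0 : ℝ)..Real.pi, Complex.exp (-Complex.I * z * Real.cos θ) *
        upperGamma 0 (logArg z θ) * Complex.cos (m * θ)) + sigma m z) := by
  obtain ⟨N, rfl | rfl⟩ := m.eq_nat_or_neg
  · exact hankel₁_natCast hz N
  · have hI : Complex.I ^ (-(N : ℤ) - 1) = (-1) ^ (N : ℤ) * Complex.I ^ ((N : ℤ) - 1) := by
      rw [zpow_sub_one₀ Complex.I_ne_zero, zpow_sub_one₀ Complex.I_ne_zero, I_zpow_neg]; ring
    rw [hI, sigma_neg]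
    simp only [Int.cast_neg, neg_mul ((N : ℤ) : ℂ), Complex.cos_neg]
    rw [hankel₁_neg_intCast hz, hankel₁_natCast hz]
    ring

theorem hankel₂_intCast {z : ℂ} (hz : z ≠ 0) (m : ℤ) : hankel₂ m z =
    -(2 * Complex.I ^ (m - 1) / Real.pi) *
      (1 / Real.pi * (∫ θ in (0 : ℝ)..Real.pi, Complex.exp (-Complex.I * z * Real.cos θ) *
        (upperGamma 0 (logArg z θ) - Complex.I * Real.pi) * Complex.cos (m * θ)) +
          sigma m z) := by
  have hpi : (Real.pi : ℂ) ≠ 0 := Complex.ofReal_ne_zero.2 Real.pi_ne_zero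
  have hsub : ∫ θ in (0 : ℝ)..Real.pi, Complex.exp (-Complex.I * z * Real.cos θ) *
        (upperGamma 0 (logArg z θ) - Complex.I * Real.pi) * Complex.cos (m * θ) =
      (∫ θ in (0 : ℝ)..Real.pi, Complex.exp (-Complex.I * z * Real.cos θ) *
        upperGamma 0 (logArg z θ) * Complex.cos (m * θ)) - Complex.I * Real.pi *
      ∫ θ in (0 : ℝ)..Real.pi, Complex.exp (-Complex.I * z * Real.cos θ) *
        Complex.cos (m * θ) := by
    rw [← intervalIntegral.integral_const_mul, ← intervalIntegral.integral_sub
      (intervalIntegrable_exp_mul_upperGamma hz m)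
      (Continuous.intervalIntegrable (by fun_prop) _ _)]
    exact intervalIntegral.integral_congr fun θ _ => by ring
  -- By Bessel's integral the term `2J_m` accounts exactly for the subtracted `iπ` in the integrand.
  have h1 : hankel₂ m z = 2 * besselJ m z - hankel₁ m z := by rw [hankel₁, hankel₂]; ring
  have hI : Complex.I ^ m = Complex.I ^ (m - 1) * Complex.I := by
    rw [← zpow_add_one₀ Complex.I_ne_zero, sub_add_cancel]
  rw [h1, hsub, hankel₁_intCast hz, besselJ_intCast hz, hI]
  field_simp
  ring

end Cylinder

end

theorem mainTheorem5 (z : ℂ) (hz : z ≠ 0) :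
    -- the integrals that define `B_μ(z)` converge absolutely
    (∀ μ : ℂ, IntervalIntegrable (Cylinder.integrandB μ z) volume 0 Real.pi) ∧
    -- non-integral order
    (∀ μ : ℂ, (∀ m : ℤ, μ ≠ m) →
      -Complex.I * Cylinder.hankel₁ μ z = Cylinder.mixed₁ μ z ∧
      Complex.I * Cylinder.hankel₂ μ z = Cylinder.mixed₂ μ z ∧
      ((Cylinder.fracPart μ).re < 1 / 2 →
        Cylinder.calH₁ μ z =
          Complex.I ^ (-μ) / (Real.pi * Complex.sin (μ * Real.pi)) *
            ∫ θ in (0 : ℝ)..Real.pi, Complex.exp (-Complex.I * z * Real.cos θ) *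
              (Cylinder.normGammaP (Cylinder.fracPart μ) (Cylinder.logArg z θ) -
                Cylinder.normGammaP (-Cylinder.fracPart μ) (Cylinder.logArg z θ)) *
              Complex.cos (μ * θ) ∧
        Cylinder.calH₂ μ z =
          Complex.I ^ μ / (Real.pi * Complex.sin (μ * Real.pi)) *
            ∫ θ in (0 : ℝ)..Real.pi, Complex.exp (-Complex.I * z * Real.cos θ) *
              (Complex.exp (Complex.I * μ * Real.pi) *
                  Cylinder.normGammaP (Cylinder.fracPart μ) (Cylinder.logArg z θ) -
                Complex.exp (-Complex.I * μ * Real.pi) *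
                  Cylinder.normGammaP (-Cylinder.fracPart μ) (Cylinder.logArg z θ)) *
              Complex.cos (μ * θ))) ∧
    -- integral order: the same representations in the limit
    (∀ m : ℤ,
      Tendsto (fun μ => Cylinder.mixed₁ μ z) (𝓝[≠] (m : ℂ))
        (𝓝 (-Complex.I * Cylinder.hankel₁ m z)) ∧
      Tendsto (fun μ => Cylinder.mixed₂ μ z) (𝓝[≠] (m : ℂ))
        (𝓝 (Complex.I * Cylinder.hankel₂ m z))) ∧
    -- integral order: the explicit representations
    (∀ m : ℤ,
      IntervalIntegrable (fun θ : ℝ => Complex.exp (-Complex.I * z * Real.cos θ) *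
        Cylinder.upperGamma 0 (Cylinder.logArg z θ) * Complex.cos (m * θ)) volume 0 Real.pi ∧
      Cylinder.hankel₁ m z =
        2 * Complex.I ^ (m - 1) / Real.pi *
          (1 / Real.pi * (∫ θ in (0 : ℝ)..Real.pi, Complex.exp (-Complex.I * z * Real.cos θ) *
              Cylinder.upperGamma 0 (Cylinder.logArg z θ) * Complex.cos (m * θ)) +
            Cylinder.sigma m z) ∧
      Cylinder.hankel₂ m z =
        -(2 * Complex.I ^ (m - 1) / Real.pi) *
          (1 / Real.pi * (∫ θ in (0 : ℝ)..Real.pi, Complex.exp (-Complex.I * z * Real.cos θ) *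
              (Cylinder.upperGamma 0 (Cylinder.logArg z θ) - Complex.I * Real.pi) *
              Complex.cos (m * θ)) +
            Cylinder.sigma m z)) := by
  refine ⟨Cylinder.intervalIntegrable_integrandB hz, fun μ hμ =>
    ⟨Cylinder.neg_I_mul_hankel₁_eq_mixed₁ hz hμ, Cylinder.I_mul_hankel₂_eq_mixed₂ hz hμ,
      fun h => ⟨Cylinder.calH₁_eq hz h, Cylinder.calH₂_eq hz h⟩⟩,
    fun m => ⟨Cylinder.tendsto_mixed₁ hz m, Cylinder.tendsto_mixed₂ hz m⟩,
    fun m => ⟨Cylinder.intervalIntegrable_exp_mul_upperGamma hz m,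
      Cylinder.hankel₁_intCast hz m, Cylinder.hankel₂_intCast hz m⟩⟩
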